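/- Let $d\ge 1$, let $\Omega\subset\mathbb{R}^d$ be a nonempty bounded open set, let $T>0$, and let $\mathcal{A}=-\Delta$ be the Laplacian on $L^2(\Omega)$ (real-valued functions) with homogeneous Dirichlet boundary conditions, understood weakly: $\mathcal{A}u=f$ means $u\in H_0^1(\Omega)$ and $\int_\Omega\nabla u\cdot\nabla\psi\,dx=\int_\Omega f\psi\,dx$ for all $\psi\in C_c^\infty(\Omega)$. Then there is an orthonormal basis $(\varphi_m)_{m\in\mathbb{N}}$ of $L^2(\Omega)$ with $\mathcal{A}^{-1}\varphi_m=\mu_m\varphi_m$, $\mu_m\in\mathbb{R}$. For every such eigensystem $(\mu_m,\varphi_m)_{m\in\mathbb{N}}$ one has $\mu_m>0$ and $\mu_m\to0$, functions of $\mathcal{A}$ are defined by $F(\mathcal{A})v=\sum_m F(1/\mu_m)\langle v,\varphi_m\rangle\varphi_m$, and the following holds. Let $\underline{I}:L^2(\Omega)\to L^2(0,T;L^2(\Omega))$ map $g$ to the constant function $t\mapsto g$, so that $\underline{I}^*f=\int_0^Tf(s)\,ds$, and let $$(Df)(t)=e^{-\mathcal{A}(T-t)}\mathcal{A}^{1/2}\int_0^Te^{-\mathcal{A}(T-s)}\mathcal{A}^{1/2}f(s)\,ds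 ,$$ where the integral is taken coefficientwise with respect to $(\varphi_m)$. On the Hilbert space $L^2(0,T;L^2(\Omega))\times L^2(\Omega)$ consider the transformed all-at-once operator of the backwards heat problem $$G=\begin{pmatrix} I+D & \underline{I}+e^{-\mathcal{A}(T-\cdot)}\\ \underline{I}^*+\int_0^Te^{-\mathcal{A}(T-s)}\,\cdot(s)\,ds & T\,I+\mathcal{A}^{-1}\end{pmatrix},\qquad G_0=\begin{pmatrix} I+D & \underline{I}\\ \underline{I}^* & T\,I\end{pmatrix}.$$ 1. $G$ and $G_0$ are bounded, $G$ is self-adjoint, and $G-G_0$ is compact. 2. $1$ is an eigenvalue of $G$. Its eigenspace is infinite-dimensional and equals the closed linear span $$E_1=\overline{\operatorname{span}}\{(\psi(t)\varphi_m(x),\,0): m\in\mathbb{N},\ \psi\in L^2(0,T),\ \psi\perp 1,\ \psi\perp e^{-(T-\cdot)/\mu_m}\}.$$ 3. Put $\alpha_m=\mu_m-\tfrac12e^{-2T/\mu_m}$, $\beta_m=2\mu_me^{-T/\mu_m}-\tfrac12e^{-2T/\mu_m}(T+1)$ and $$p_m(\lambda)=\lambda^3-\lambda^2\bigl(T+\tfrac52+\alpha_m\bigr)+\lambda\bigl(\tfrac32(T+1)+\beta_m\bigr)-\mu_me^{-2T/\mu_m}.$$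 The set of eigenvalues of $G$ is $\{1\}\cup\bigcup_m\{\lambda\in\mathbb{R}:p_m(\lambda)=0\}$, and the spectrum of $G$ is $\{0,1,\tfrac32,T+1\}\cup\bigcup_m\{\lambda\in\mathbb{R}:p_m(\lambda)=0\}$. 4. Put $\Delta_m=(T-\tfrac12)^2+\alpha_m^2+(2T+5)\alpha_m-4\beta_m$, $\bar\lambda_{2,m}=\tfrac12(T+\tfrac52+\alpha_m)+\tfrac12\sqrt{\Delta_m}$ and $\bar\lambda_{3,m}=\bigl(\tfrac32(T+1)+\beta_m\bigr)/\bar\lambda_{2,m}$. For all sufficiently large $m$ one has $\Delta_m\ge0$ and $$p_m(\lambda)=\lambda(\lambda-\bar\lambda_{2,m})(\lambda-\bar\lambda_{3,m})-\mu_me^{-2T/\mu_m}\quad\text{for all }\lambda\in\mathbb{R};$$ moreover $\bar\lambda_{2,m}\to\max\{T+1,\tfrac32\}$ and $\bar\lambda_{3,m}\to\min\{T+1,\tfrac32\}$ as $m\to\infty$. 5. There are real sequences $(\lambda^1_m),(\lambda^2_m),(\lambda^3_m)$ such that, for every $m$, $p_m(\lambda)=(\lambda-\lambda^1_m)(\lambda-\lambda^2_m)(\lambda-\lambda^3_m)$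 for all $\lambda\in\mathbb{R}$, and such that $\lambda^1_m>0$ for all $m$, $\lambda^1_m=O(\mu_me^{-2T/\mu_m})$ (in particular $\lambda^1_m\to0$), $\lambda^2_m\to\tfrac32$ and $\lambda^3_m\to T+1$ as $m\to\infty$. -/

import Mathlib

open MeasureTheory Filter Topology Asymptotics
open scoped ContDiff

noncomputable section

namespace BackwardHeat

/-- Euclidean space `ℝᵈ`. -/
abbrev E (d : ℕ) : Type := EuclideanSpace ℝ (Fin d)

/-- The real Hilbert space `L²(Ω)`. -/
abbrev L2 {d : ℕ} (Ω : Set (E d)) : Type := Lp ℝ 2 (volume.restrict Ω)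

/-- The real Hilbert space `L²(Ω; ℝᵈ)`. -/
abbrev L2Vec {d : ℕ} (Ω : Set (E d)) : Type := Lp (E d) 2 (volume.restrict Ω)

/-- All pairs `(ψ, ∇ψ)` with `ψ ∈ C_c^∞(Ω)`, as elements of `L²(Ω) × L²(Ω; ℝᵈ)`. -/
def testGraph {d : ℕ} (Ω : Set (E d)) : Set (L2 Ω × L2Vec Ω) :=
  {w | ∃ ψ : E d → ℝ, ContDiff ℝ ∞ ψ ∧ HasCompactSupport ψ ∧ tsupport ψ ⊆ Ω ∧
    (∀ᵐ x ∂(volume.restrict Ω), w.1 x = ψ x) ∧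
    (∀ᵐ x ∂(volume.restrict Ω), w.2 x = gradient ψ x)}

/-- All pairs `(u, ∇u)` with `u ∈ H₀¹(Ω)`: `H₀¹(Ω)` is the closure of `C_c^∞(Ω)` in the
`H¹`-norm, and the second component is the weak gradient. -/
def sobolevGraph {d : ℕ} (Ω : Set (E d)) : Set (L2 Ω × L2Vec Ω) := closure (testGraph Ω)

/-- `A u = f`, where `A = -Δ` is the Dirichlet Laplacian and `f ∈ L²(Ω)`: `u ∈ H₀¹(Ω)` and
`∫_Ω ∇u · ∇ψ = ∫_Ω f ψ` for all `ψ ∈ C_c^∞(Ω)`. -/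
def DirichletLaplaceEq {d : ℕ} (Ω : Set (E d)) (u f : L2 Ω) : Prop :=
  ∃ p : L2Vec Ω, (u, p) ∈ sobolevGraph Ω ∧
    ∀ w ∈ testGraph Ω, inner ℝ p w.2 = inner ℝ f w.1

/-- An eigensystem `(μₙ, φₙ)` of `A⁻¹`: the `φₙ` are a complete orthonormal system of `L²(Ω)`
and `A⁻¹ φₙ = μₙ φₙ`, that is, `A (μₙ φₙ) = φₙ`. -/
structure Eigensystem {d : ℕ} (Ω : Set (E d)) where
  /-- the eigenfunctions -/
  φ : HilbertBasis ℕ ℝ (L2 Ω)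
  /-- the eigenvalues of `A⁻¹` -/
  μ : ℕ → ℝ
  eigen : ∀ n, DirichletLaplaceEq Ω (μ n • φ n) (φ n)

namespace Eigensystem

variable {d : ℕ} {Ω : Set (E d)}

/-- The spectral calculus `F(A) v = ∑ₙ F(1/μₙ) ⟨φₙ, v⟩ φₙ` of the Dirichlet Laplacian `A`. -/
def calculus (e : Eigensystem Ω) (F : ℝ → ℝ) (v : L2 Ω) : L2 Ω :=
  ∑' n, (F (e.μ n)⁻¹ * inner ℝ (e.φ n) v) • e.φ n

/-- `A⁻¹`. -/
def invA (e : Eigensystem Ω) (v : L2 Ω) : L2 Ω := e.calculus (fun γ => γ⁻¹) v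

/-- The heat semigroup `e^{-τA}`. -/
def heat (e : Eigensystem Ω) (τ : ℝ) (v : L2 Ω) : L2 Ω :=
  e.calculus (fun γ => Real.exp (-(γ * τ))) v

/-- `e^{-τA} A^{1/2}`, a bounded operator for `τ > 0`. -/
def heatSqrt (e : Eigensystem Ω) (τ : ℝ) (v : L2 Ω) : L2 Ω :=
  e.calculus (fun γ => Real.exp (-(γ * τ)) * √γ) v

end Eigensystem

/-- The Bochner space `L²(0,T; L²(Ω))`. -/
abbrev L2Time {d : ℕ} (T : ℝ) (Ω : Set (E d)) : Type :=
  Lp (L2 Ω) 2 (volume.restrict (Set.Ioo 0 T))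

/-- The Hilbert space `L²(0,T; L²(Ω)) × L²(Ω)`. -/
abbrev Z {d : ℕ} (T : ℝ) (Ω : Set (E d)) : Type := WithLp 2 (L2Time T Ω × L2 Ω)

namespace Eigensystem

variable {d : ℕ} {Ω : Set (E d)}

/-- `∫₀ᵀ e^{-A(T-s)} A^{1/2} f(s) ds`. For general `f ∈ L²(0,T; L²(Ω))` the norm of the integrand
need not be integrable; the integral is the weak one, that is, it is taken coefficient by
coefficient with respect to the eigenfunctions. -/
def heatSqrtIntegral (e : Eigensystem Ω) (T : ℝ) (f : L2Time T Ω) : L2 Ω :=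
  ∑' n, (∫ s in Set.Ioo 0 T,
    Real.exp (-((e.μ n)⁻¹ * (T - s))) * √((e.μ n)⁻¹) * inner ℝ (e.φ n) (f s)) • e.φ n

/-- `(D f)(t) = e^{-A(T-t)} A^{1/2} ∫₀ᵀ e^{-A(T-s)} A^{1/2} f(s) ds`. -/
def opD (e : Eigensystem Ω) (T : ℝ) (f : L2Time T Ω) (t : ℝ) : L2 Ω :=
  e.heatSqrt (T - t) (e.heatSqrtIntegral T f)

/-- `G` is the transformed all-at-once operator
`[[I + D, I̲ + e^{-A(T-·)}], [I̲* + ∫₀ᵀ e^{-A(T-s)} ·(s) ds, T I + A⁻¹]]`,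
where `I̲ g` is the constant function `g` of time and `I̲* f = ∫₀ᵀ f(s) ds`. -/
def IsTransformedOperator (e : Eigensystem Ω) (T : ℝ) (G : Z T Ω →L[ℝ] Z T Ω) : Prop :=
  ∀ z : Z T Ω,
    (∀ᵐ t ∂(volume.restrict (Set.Ioo 0 T)),
      (G z).fst t = (z.fst t + e.opD T z.fst t) + (z.snd + e.heat (T - t) z.snd)) ∧
    (G z).snd = ((∫ s in Set.Ioo 0 T, z.fst s) + ∫ s in Set.Ioo 0 T, e.heat (T - s) (z.fst s))
      + (T • z.snd + e.invA z.snd)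

/-- `G₀` is the operator `[[I + D, I̲], [I̲*, T I]]`. -/
def IsUnperturbedOperator (e : Eigensystem Ω) (T : ℝ) (G₀ : Z T Ω →L[ℝ] Z T Ω) : Prop :=
  ∀ z : Z T Ω,
    (∀ᵐ t ∂(volume.restrict (Set.Ioo 0 T)),
      (G₀ z).fst t = (z.fst t + e.opD T z.fst t) + z.snd) ∧
    (G₀ z).snd = (∫ s in Set.Ioo 0 T, z.fst s) + T • z.snd

/-- The functions `(t, x) ↦ ψ(t) φₘ(x)`, paired with `g = 0`, where `ψ ∈ L²(0,T)` is orthogonal to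
`t ↦ 1` and to `t ↦ e^{-(T-t)/μₘ}`. -/
def unitEigenvectors (e : Eigensystem Ω) (T : ℝ) : Set (Z T Ω) :=
  {z | ∃ (m : ℕ) (ψ : Lp ℝ 2 (volume.restrict (Set.Ioo 0 T))),
    (∫ t in Set.Ioo 0 T, ψ t) = 0 ∧
    (∫ t in Set.Ioo 0 T, Real.exp (-((e.μ m)⁻¹ * (T - t))) * ψ t) = 0 ∧
    (∀ᵐ t ∂(volume.restrict (Set.Ioo 0 T)), z.fst t = ψ t • e.φ m) ∧ z.snd = 0}

end Eigensystem

/-- `α = μ - ½ e^{-2T/μ}`. -/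
def alpha (T μ : ℝ) : ℝ := μ - Real.exp (-(2 * T / μ)) / 2

/-- `β = 2 μ e^{-T/μ} - ½ e^{-2T/μ} (T + 1)`. -/
def beta (T μ : ℝ) : ℝ :=
  2 * μ * Real.exp (-(T / μ)) - Real.exp (-(2 * T / μ)) * (T + 1) / 2

/-- `λ³ - λ² (T + 5/2 + α) + λ (3/2 (T + 1) + β) - μ e^{-2T/μ}`. -/
def cubic (T μ x : ℝ) : ℝ :=
  x ^ 3 - x ^ 2 * (T + 5 / 2 + alpha T μ) + x * (3 / 2 * (T + 1) + beta T μ)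
    - μ * Real.exp (-(2 * T / μ))

/-- The discriminant `(T - ½)² + α² + (2T + 5) α - 4 β`. -/
def disc (T μ : ℝ) : ℝ :=
  (T - 1 / 2) ^ 2 + alpha T μ ^ 2 + (2 * T + 5) * alpha T μ - 4 * beta T μ

/-- The approximate eigenvalue `λ̄₂`. -/
def lamBar₂ (T μ : ℝ) : ℝ := (T + 5 / 2 + alpha T μ) / 2 + √(disc T μ) / 2

/-- The approximate eigenvalue `λ̄₃`. -/
def lamBar₃ (T μ : ℝ) : ℝ := (3 / 2 * (T + 1) + beta T μ) / lamBar₂ T μ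

end BackwardHeat

end

/-!
The eigenfunctions `φₘ` split the state space `L²(0, T; L²(Ω)) × L²(Ω)` into the orthogonal modes
`{(ψ(t) φₘ, g φₘ)}`, each a copy of `L²(0, T) × ℝ` (`modeEmbed`, `isHilbertSum_modeEmbed`). All entries
of `G` and `G₀` are functions of the Laplacian, so both operators are block-diagonal with respect to
this splitting. With `b = 1` and `e = e^{-(T-t)/μ}`, `μ = μₘ`, the block of `G` is
`(f, g) ↦ (f + μ⁻¹ ⟨e, f⟩ e + g (b + e), ⟨b, f⟩ + ⟨e, f⟩ + (T + μ) g)` (`modeOp`), a symmetric operator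
that differs from the identity only on the span of `(b, 0)`, `(e, 0)`, `(0, 1)`. Conversely `G` is
constructed from its blocks (`exists_isBlockDiagonal`), which are bounded uniformly in `m` since
`‖e‖² ≤ μ`. The blocks of `G - G₀` have rank at most two and norm `O(√μ + μ)`, so `G - G₀` is compact.

On the three-dimensional span the characteristic polynomial of the block is the cubic `pₘ`.
The Gram determinant of `b, e` is `μ pₘ(1) > 0`, which is the inequality `tanh x < x`; hence the
eigenspace of the block for `1` is exactly the orthogonal complement of `b, e`, with `g = 0`, and every
root of `pₘ` has an explicit eigenvector. By Cayley–Hamilton `pₘ(A) (A - 1) = 0` for the block `A`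
(`IsModePair.cubic_modeOp_eq_zero`), so away from `1` and the roots the resolvent of `A` is a polynomial
in `A`, divided by `pₘ(λ) (λ - 1)` (`cubicResolvent_mul`). As `μ → 0` the value `pₘ(λ)` tends to
`λ (λ - 3/2) (λ - (T + 1))`, and so the resolvents of all blocks are bounded uniformly unless `λ` is
`0`, `3/2` or `T + 1`. These three points are limits of roots, and they lie in the spectrum because it
is closed (`Eigensystem.spectrum_eq`).

The cubic is negative at `0`, positive at `1`, and negative at `T + 1`; thus it has three real roots,
one in each of `(0, 1)`, `(1, T + 1)`, `(T + 1, ∞)` (`exists_roots_cubic`). The product of the roots is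
`μ e^{-2T/μ}` and the two larger ones exceed `1`, which bounds the smallest root; the limits of
the others follow from their sum and product (`exists_root_functions`).

For the Dirichlet Laplacian, the inequality `‖ψ(· + z) - ψ‖ ≤ ‖z‖ ‖∇ψ‖` for test functions gives
Poincaré's inequality (`exists_poincare`), by a translation that moves `ψ` off its support, and a
quantitative form of the Rellich–Kondrachov theorem (`exists_finite_averages`): up to a small multiple
of its gradient, a function in `H₀¹(Ω)` is controlled by finitely many of its averages. The Lax–Milgram
theorem then provides a compact symmetric inverse of the Laplacian, and the spectral theorem an
eigensystem (`nonempty_eigensystem`). For an arbitrary eigensystem the energy of `μₙ φₙ` is `μₙ`, which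
yields `μₙ > 0`, and the inequality of `exists_finite_averages`, applied to `μₙ φₙ`, yields `μₙ → 0`.
-/

namespace BackwardHeat

/-! ### The cubic and its roots -/

lemma exp_neg_two_mul_div (T μ : ℝ) :
    Real.exp (-(2 * T / μ)) = Real.exp (-(T / μ)) ^ 2 := by
  rw [← Real.exp_nat_mul]; congr 1; push_cast; ring

/-- `tanh (y / 2) < y / 2` with the denominators cleared. -/
lemma one_sub_exp_neg_lt {y : ℝ} (hy : 0 < y) :
    1 - Real.exp (-y) < y / 2 * (1 + Real.exp (-y)) := by
  have hd : ∀ x : ℝ, HasDerivAt (fun x => x / 2 * (1 + Real.exp (-x)) - (1 - Real.exp (-x)))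
      ((1 - Real.exp (-x) * (1 + x)) / 2) x := by
    intro x
    have h1 : HasDerivAt (fun x : ℝ => Real.exp (-x)) (-Real.exp (-x)) x := by
      simpa using (hasDerivAt_neg x).exp
    convert! ((((hasDerivAt_id x).div_const 2).mul (h1.const_add 1)).sub
      (h1.const_sub 1)) using 1
    simp only [id]; ring
  have hmono : StrictMonoOn (fun x => x / 2 * (1 + Real.exp (-x)) - (1 - Real.exp (-x)))
      (Set.Ici (0 : ℝ)) := by
    refine strictMonoOn_of_deriv_pos (convex_Ici 0)
      (fun x _ => (hd x).continuousAt.continuousWithinAt) ?_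
    intro x hx
    rw [interior_Ici, Set.mem_Ioi] at hx
    rw [(hd x).deriv]
    have h1 : x + 1 < Real.exp x := Real.add_one_lt_exp hx.ne'
    have h2 : Real.exp (-x) * Real.exp x = 1 := by rw [← Real.exp_add]; simp
    have h3 := Real.exp_pos (-x)
    nlinarith
  have := hmono (Set.self_mem_Ici (a := (0 : ℝ))) hy.le hy
  simp only [neg_zero, Real.exp_zero] at this
  linarith

lemma cubic_zero (T μ : ℝ) : cubic T μ 0 = -(μ * Real.exp (-(T / μ)) ^ 2) := by
  rw [cubic, exp_neg_two_mul_div]; ring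

lemma cubic_one (T μ : ℝ) : cubic T μ 1 = (1 - Real.exp (-(T / μ))) *
    (T / 2 * (1 + Real.exp (-(T / μ))) - μ * (1 - Real.exp (-(T / μ)))) := by
  rw [cubic, alpha, beta, exp_neg_two_mul_div]; ring

lemma cubic_add_one (T μ : ℝ) :
    cubic T μ (T + 1) = -(μ * (T + 1 - Real.exp (-(T / μ))) ^ 2) := by
  rw [cubic, alpha, beta, exp_neg_two_mul_div]; ring

lemma exp_neg_div_lt_one {T μ : ℝ} (hT : 0 < T) (hμ : 0 < μ) : Real.exp (-(T / μ)) < 1 := by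
  rw [Real.exp_lt_one_iff]; have := div_pos hT hμ; linarith

lemma cubic_one_pos {T μ : ℝ} (hT : 0 < T) (hμ : 0 < μ) : 0 < cubic T μ 1 := by
  rw [cubic_one]
  have h1 := exp_neg_div_lt_one hT hμ
  have h2 := one_sub_exp_neg_lt (div_pos hT hμ)
  refine mul_pos (by linarith) ?_
  have h3 : T / 2 * (1 + Real.exp (-(T / μ))) =
      μ * (T / μ / 2 * (1 + Real.exp (-(T / μ)))) := by field_simp
  rw [h3, ← mul_sub]
  exact mul_pos hμ (by linarith)

lemma continuous_cubic (T μ : ℝ) : Continuous (cubic T μ) := by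
  unfold cubic; fun_prop

/-- Vieta's formulas for three distinct roots. -/
lemma vieta_of_roots {A B C r s t : ℝ} (hrs : r ≠ s) (hrt : r ≠ t) (hst : s ≠ t)
    (hr : r ^ 3 - r ^ 2 * A + r * B - C = 0) (hs : s ^ 3 - s ^ 2 * A + s * B - C = 0)
    (ht : t ^ 3 - t ^ 2 * A + t * B - C = 0) :
    r + s + t = A ∧ r * s + r * t + s * t = B ∧ r * s * t = C := by
  have h1 : r ^ 2 + r * s + s ^ 2 - A * (r + s) + B = 0 :=
    mul_left_cancel₀ (sub_ne_zero.2 hrs) (by linear_combination hr - hs)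
  have h2 : r ^ 2 + r * t + t ^ 2 - A * (r + t) + B = 0 :=
    mul_left_cancel₀ (sub_ne_zero.2 hrt) (by linear_combination hr - ht)
  have h3 : r + s + t = A :=
    mul_left_cancel₀ (sub_ne_zero.2 hst) (by linear_combination h1 - h2)
  have h4 : r * s + r * t + s * t = B := by rw [← h3] at h1; linear_combination -h1
  refine ⟨h3, h4, ?_⟩
  rw [← h3, ← h4] at hr
  linear_combination hr

/-- The sign pattern `-, +, -, +` of the cubic at `0`, `1`, `T + 1` and `∞` separates its roots. -/
lemma exists_roots_cubic {T μ : ℝ} (hT : 0 < T) (hμ : 0 < μ) :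
    ∃ r s t : ℝ, 0 < r ∧ r < 1 ∧ 1 < s ∧ s < T + 1 ∧ T + 1 < t ∧
      r + s + t = T + 5 / 2 + alpha T μ ∧
      r * s + r * t + s * t = 3 / 2 * (T + 1) + beta T μ ∧
      r * s * t = μ * Real.exp (-(2 * T / μ)) := by
  have hq := Real.exp_pos (-(T / μ))
  have hq1 := exp_neg_div_lt_one hT hμ
  have h0 : cubic T μ 0 < 0 := by
    rw [cubic_zero]; have := mul_pos hμ (pow_pos hq 2); linarith
  have h1 := cubic_one_pos hT hμ
  have h2 : cubic T μ (T + 1) < 0 := by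
    rw [cubic_add_one]
    have : 0 < T + 1 - Real.exp (-(T / μ)) := by linarith
    have := mul_pos hμ (pow_pos this 2); linarith
  -- the sign at `∞`, at a point that exceeds `1` and the sum of the absolute coefficients
  have h3 : ∃ x, T + 1 < x ∧ 0 < cubic T μ x := by
    set M := T + 2 + |T + 5 / 2 + alpha T μ| + |3 / 2 * (T + 1) + beta T μ|
      + |μ * Real.exp (-(2 * T / μ))| with hM
    have a1 := abs_nonneg (T + 5 / 2 + alpha T μ)
    have a2 := abs_nonneg (3 / 2 * (T + 1) + beta T μ)
    have a3 := abs_nonneg (μ * Real.exp (-(2 * T / μ)))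
    have b1 := le_abs_self (T + 5 / 2 + alpha T μ)
    have b2 := neg_abs_le (3 / 2 * (T + 1) + beta T μ)
    have b3 := le_abs_self (μ * Real.exp (-(2 * T / μ)))
    refine ⟨M, by linarith, ?_⟩
    have hM1 : 1 < M := by linarith
    rw [cubic]
    generalize |T + 5 / 2 + alpha T μ| = u at *
    generalize |3 / 2 * (T + 1) + beta T μ| = v at *
    generalize |μ * Real.exp (-(2 * T / μ))| = w at *
    generalize T + 5 / 2 + alpha T μ = A at *
    generalize 3 / 2 * (T + 1) + beta T μ = B at *
    generalize μ * Real.exp (-(2 * T / μ)) = C at *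
    have c1 : M ^ 2 * A ≤ M ^ 2 * u := mul_le_mul_of_nonneg_left b1 (sq_nonneg M)
    have c2 : -(M ^ 2 * v) ≤ M * B := by nlinarith [mul_nonneg (sub_nonneg.2 hM1.le) a2]
    have c3 : C ≤ M ^ 2 * w := b3.trans (le_mul_of_one_le_left a3 (one_le_pow₀ hM1.le))
    have c4 : 0 < M ^ 2 * (M - u - v - w) := mul_pos (by positivity) (by linarith)
    nlinarith
  obtain ⟨x, hx, h3⟩ := h3
  have hc := continuous_cubic T μ
  obtain ⟨r, hr, hr0⟩ := intermediate_value_Ioo zero_le_one hc.continuousOn ⟨h0, h1⟩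
  obtain ⟨s, hs, hs0⟩ :=
    intermediate_value_Ioo' (by linarith : (1 : ℝ) ≤ T + 1) hc.continuousOn ⟨h2, h1⟩
  obtain ⟨t, ht, ht0⟩ := intermediate_value_Ioo hx.le hc.continuousOn ⟨h2, h3⟩
  obtain ⟨v1, v2, v3⟩ := vieta_of_roots (hr.2.trans hs.1).ne
    ((hr.2.trans hs.1).trans (hs.2.trans ht.1)).ne (hs.2.trans ht.1).ne hr0 hs0 ht0
  exact ⟨r, s, t, hr.1, hr.2, hs.1, hs.2, ht.1, v1, v2, v3⟩

lemma tendsto_exp_neg_div {c : ℝ} (hc : 0 < c) :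
    Tendsto (fun μ : ℝ => Real.exp (-(c / μ))) (𝓝[>] 0) (𝓝 0) := by
  refine Real.tendsto_exp_neg_atTop_nhds_zero.comp ?_
  simpa only [div_eq_mul_inv] using! tendsto_inv_nhdsGT_zero.const_mul_atTop hc

lemma tendsto_id_nhdsGT_zero : Tendsto (fun μ : ℝ => μ) (𝓝[>] 0) (𝓝 0) :=
  tendsto_id.mono_left nhdsWithin_le_nhds

lemma tendsto_alpha {T : ℝ} (hT : 0 < T) : Tendsto (alpha T) (𝓝[>] 0) (𝓝 0) := by
  have h := tendsto_id_nhdsGT_zero.sub ((tendsto_exp_neg_div (by positivity : 0 < 2 * T)).div_const 2)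
  simpa only [sub_zero, zero_div] using! h

lemma tendsto_beta {T : ℝ} (hT : 0 < T) : Tendsto (beta T) (𝓝[>] 0) (𝓝 0) := by
  have h := ((tendsto_id_nhdsGT_zero.const_mul 2).mul (tendsto_exp_neg_div hT)).sub
    (((tendsto_exp_neg_div (by positivity : 0 < 2 * T)).mul_const (T + 1)).div_const 2)
  simpa only [sub_zero, zero_div, mul_zero, zero_mul] using! h

lemma tendsto_disc {T : ℝ} (hT : 0 < T) :
    Tendsto (disc T) (𝓝[>] 0) (𝓝 ((T - 1 / 2) ^ 2)) := by
  have h := ((((tendsto_alpha hT).pow 2).const_add ((T - 1 / 2) ^ 2)).add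
    ((tendsto_alpha hT).const_mul (2 * T + 5))).sub ((tendsto_beta hT).const_mul 4)
  simpa only [sub_zero, add_zero, zero_pow two_ne_zero, mul_zero] using! h

lemma max_add_one_eq (T : ℝ) : max (T + 1) (3 / 2) = (T + 5 / 2) / 2 + |T - 1 / 2| / 2 := by
  rcases le_total (T - 1 / 2) 0 with h | h
  · rw [max_eq_right (by linarith), abs_of_nonpos h]; ring
  · rw [max_eq_left (by linarith), abs_of_nonneg h]; ring

lemma min_add_one_eq (T : ℝ) : min (T + 1) (3 / 2) = (T + 5 / 2) / 2 - |T - 1 / 2| / 2 := by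
  rcases le_total (T - 1 / 2) 0 with h | h
  · rw [min_eq_left (by linarith), abs_of_nonpos h]; ring
  · rw [min_eq_right (by linarith), abs_of_nonneg h]; ring

lemma tendsto_lamBar₂ {T : ℝ} (hT : 0 < T) :
    Tendsto (lamBar₂ T) (𝓝[>] 0) (𝓝 (max (T + 1) (3 / 2))) := by
  have h := (((tendsto_alpha hT).const_add (T + 5 / 2)).div_const 2).add
    ((tendsto_disc hT).sqrt.div_const 2)
  rw [Real.sqrt_sq_eq_abs, add_zero, ← max_add_one_eq] at h
  exact h

lemma tendsto_lamBar₃ {T : ℝ} (hT : 0 < T) :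
    Tendsto (lamBar₃ T) (𝓝[>] 0) (𝓝 (min (T + 1) (3 / 2))) := by
  have hpos : 0 < max (T + 1) (3 / 2) := lt_max_of_lt_right (by norm_num)
  have h := ((tendsto_beta hT).const_add (3 / 2 * (T + 1))).div (tendsto_lamBar₂ hT) hpos.ne'
  have e : (3 / 2 * (T + 1) + 0) / max (T + 1) (3 / 2) = min (T + 1) (3 / 2) := by
    rw [div_eq_iff hpos.ne', min_mul_max]; ring
  rw [e] at h
  exact h

/-- In the case `T = 1 / 2` the discriminant tends to `0`, and its sign is decided by
`α ≈ μ`, which dominates the exponentially small `β`. -/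
lemma eventually_disc_nonneg {T : ℝ} (hT : 0 < T) : ∀ᶠ μ in 𝓝[>] 0, 0 ≤ disc T μ := by
  -- `e^{-T/μ} < 1/4` gives `β ≤ μ / 2`, and `μ < 2 T²` gives `e^{-2T/μ} ≤ μ`, so `α ≥ μ / 2`
  have hq := (tendsto_exp_neg_div (by positivity : 0 < T)).eventually_lt_const
    (by norm_num : (0 : ℝ) < 1 / 4)
  have hm := tendsto_id_nhdsGT_zero.eventually_lt_const (by positivity : 0 < T ^ 2 * 2)
  filter_upwards [self_mem_nhdsWithin, hq, hm] with μ (hμ : 0 < μ) hq hm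
  have hq0 := Real.exp_pos (-(T / μ))
  have h1 : Real.exp (-(2 * T / μ)) ≤ μ := by
    have hy : 0 < 2 * T / μ := by positivity
    have h2 := Real.quadratic_le_exp_of_nonneg hy.le
    have h3 : Real.exp (-(2 * T / μ)) * Real.exp (2 * T / μ) = 1 := by
      rw [← Real.exp_add]; simp
    have h4 : 1 ≤ μ * ((2 * T / μ) ^ 2 / 2) := by
      rw [show μ * ((2 * T / μ) ^ 2 / 2) = T ^ 2 * 2 / μ by field_simp,
        le_div_iff₀ hμ]
      linarith
    have h5 : 1 ≤ μ * Real.exp (2 * T / μ) := h4.trans (by gcongr; linarith)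
    have h6 := Real.exp_pos (2 * T / μ)
    nlinarith
  have h2 := Real.exp_pos (-(2 * T / μ))
  have ha : μ / 2 ≤ alpha T μ := by rw [alpha]; linarith
  have hb : beta T μ ≤ μ / 2 := by
    rw [beta]
    have : 0 ≤ Real.exp (-(2 * T / μ)) * (T + 1) := by positivity
    nlinarith
  rw [disc]
  nlinarith [sq_nonneg (T - 1 / 2), sq_nonneg (alpha T μ), mul_pos hT hμ]

lemma eventually_cubic_eq {T : ℝ} (hT : 0 < T) : ∀ᶠ μ in 𝓝[>] 0, 0 ≤ disc T μ ∧
    ∀ x : ℝ, cubic T μ x = x * (x - lamBar₂ T μ) * (x - lamBar₃ T μ)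
      - μ * Real.exp (-(2 * T / μ)) := by
  have hpos : 0 < max (T + 1) (3 / 2) := lt_max_of_lt_right (by norm_num)
  filter_upwards [eventually_disc_nonneg hT, (tendsto_lamBar₂ hT).eventually_const_lt hpos]
    with μ hd hl
  refine ⟨hd, fun x => ?_⟩
  have hsq : √(disc T μ) ^ 2 = disc T μ := Real.sq_sqrt hd
  have hprod : lamBar₂ T μ * lamBar₃ T μ = 3 / 2 * (T + 1) + beta T μ := by
    rw [lamBar₃]; field_simp
  -- `λ̄₂` is a root of `x² - (T + 5/2 + α) x + (3/2 (T + 1) + β)`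
  have hquad : lamBar₂ T μ * (T + 5 / 2 + alpha T μ - lamBar₂ T μ)
      = 3 / 2 * (T + 1) + beta T μ := by
    rw [lamBar₂]
    rw [disc] at hsq ⊢
    linear_combination -hsq / 4
  have hsum : lamBar₃ T μ = T + 5 / 2 + alpha T μ - lamBar₂ T μ :=
    mul_left_cancel₀ hl.ne' (hprod.trans hquad.symm)
  rw [hsum] at hprod ⊢
  rw [cubic]
  linear_combination -x * hprod

/-- The smallest root is at most the product of all roots, because the others exceed `1`. The
other two are recovered from their sum and product, which converge. -/
lemma exists_root_functions {T : ℝ} (hT : 0 < T) : ∃ l₁ l₂ l₃ : ℝ → ℝ,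
    (∀ μ, 0 < μ → ∀ x : ℝ, cubic T μ x = (x - l₁ μ) * (x - l₂ μ) * (x - l₃ μ)) ∧
    (∀ μ, 0 < μ → 0 < l₁ μ ∧ l₁ μ ≤ μ * Real.exp (-(2 * T / μ))) ∧
    Tendsto l₁ (𝓝[>] 0) (𝓝 0) ∧ Tendsto l₂ (𝓝[>] 0) (𝓝 (3 / 2)) ∧
    Tendsto l₃ (𝓝[>] 0) (𝓝 (T + 1)) := by
  have hex : ∀ μ : ℝ, ∃ r s t : ℝ, 0 < μ → (0 < r ∧ r < 1 ∧ 1 < s ∧ s < T + 1 ∧ T + 1 < t ∧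
      r + s + t = T + 5 / 2 + alpha T μ ∧
      r * s + r * t + s * t = 3 / 2 * (T + 1) + beta T μ ∧
      r * s * t = μ * Real.exp (-(2 * T / μ))) := by
    intro μ
    by_cases hμ : 0 < μ
    · obtain ⟨r, s, t, h⟩ := exists_roots_cubic hT hμ
      exact ⟨r, s, t, fun _ => h⟩
    · exact ⟨0, 0, 0, fun h => absurd h hμ⟩
  choose r s t h using hex
  have hfac : ∀ μ, 0 < μ → ∀ x : ℝ, cubic T μ x = (x - r μ) * (x - s μ) * (x - t μ) := by
    intro μ hμ x
    obtain ⟨-, -, -, -, -, h1, h2, h3⟩ := h μ hμ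
    rw [cubic, ← h1, ← h2, ← h3]; ring
  have hr : ∀ μ, 0 < μ → 0 < r μ ∧ r μ ≤ μ * Real.exp (-(2 * T / μ)) := by
    intro μ hμ
    obtain ⟨h1, h2, h3, h4, h5, -, -, h6⟩ := h μ hμ
    refine ⟨h1, ?_⟩
    rw [← h6, mul_assoc]
    exact le_mul_of_one_le_right h1.le (one_le_mul_of_one_le_of_one_le h3.le (by linarith))
  have hC : Tendsto (fun μ : ℝ => μ * Real.exp (-(2 * T / μ))) (𝓝[>] 0) (𝓝 0) := by
    simpa using tendsto_id_nhdsGT_zero.mul (tendsto_exp_neg_div (by positivity : 0 < 2 * T))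
  have hr0 : Tendsto r (𝓝[>] 0) (𝓝 0) := by
    refine squeeze_zero' ?_ ?_ hC
    · filter_upwards [self_mem_nhdsWithin] with μ hμ using (hr μ hμ).1.le
    · filter_upwards [self_mem_nhdsWithin] with μ hμ using (hr μ hμ).2
  -- the sum and the difference of the two larger roots
  have hS : Tendsto (fun μ => s μ + t μ) (𝓝[>] 0) (𝓝 (T + 5 / 2)) := by
    have := ((tendsto_alpha hT).const_add (T + 5 / 2)).sub hr0
    rw [add_zero, sub_zero] at this
    refine this.congr' ?_
    filter_upwards [self_mem_nhdsWithin] with μ hμ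
    obtain ⟨-, -, -, -, -, h1, -, -⟩ := h μ hμ
    linarith
  have hP : Tendsto (fun μ => s μ * t μ) (𝓝[>] 0) (𝓝 (3 / 2 * (T + 1))) := by
    have := ((tendsto_beta hT).const_add (3 / 2 * (T + 1))).sub (hr0.mul hS)
    rw [add_zero, zero_mul, sub_zero] at this
    refine this.congr' ?_
    filter_upwards [self_mem_nhdsWithin] with μ hμ
    obtain ⟨-, -, -, -, -, -, h1, -⟩ := h μ hμ
    linarith
  have hD : Tendsto (fun μ => t μ - s μ) (𝓝[>] 0) (𝓝 |T - 1 / 2|) := by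
    have := ((hS.pow 2).sub (hP.const_mul 4)).sqrt
    rw [show (T + 5 / 2) ^ 2 - 4 * (3 / 2 * (T + 1)) = (T - 1 / 2) ^ 2 by ring,
      Real.sqrt_sq_eq_abs] at this
    refine this.congr' ?_
    filter_upwards [self_mem_nhdsWithin] with μ hμ
    obtain ⟨-, -, -, h4, h5, -, -, -⟩ := h μ hμ
    rw [show (s μ + t μ) ^ 2 - 4 * (s μ * t μ) = (t μ - s μ) ^ 2 by ring]
    exact Real.sqrt_sq (by linarith)
  have hs : Tendsto s (𝓝[>] 0) (𝓝 (min (T + 1) (3 / 2))) := by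
    rw [min_add_one_eq]
    refine ((hS.div_const 2).sub (hD.div_const 2)).congr fun μ => ?_
    ring
  have ht : Tendsto t (𝓝[>] 0) (𝓝 (max (T + 1) (3 / 2))) := by
    rw [max_add_one_eq]
    refine ((hS.div_const 2).add (hD.div_const 2)).congr fun μ => ?_
    ring
  -- `s < t` are ordered by size, whereas `3 / 2` and `T + 1` may come in either order
  rcases le_total (T + 1) (3 / 2) with hle | hle
  · rw [min_eq_left hle] at hs
    rw [max_eq_right hle] at ht
    refine ⟨r, t, s, fun μ hμ x => ?_, hr, hr0, ht, hs⟩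
    rw [hfac μ hμ x]; ring
  · rw [min_eq_right hle] at hs
    rw [max_eq_left hle] at ht
    exact ⟨r, s, t, hfac, hr, hr0, hs, ht⟩

end BackwardHeat

namespace BackwardHeat

/-! ### Test functions: translations, the Poincaré inequality, averages over cubes -/

variable {d : ℕ} {ψ : E d → ℝ}

lemma gradient_eq_toDual_symm (ψ : E d → ℝ) :
    gradient ψ = fun x => (InnerProductSpace.toDual ℝ (E d)).symm (fderiv ℝ ψ x) := rfl

lemma continuous_gradient (hψ : ContDiff ℝ ∞ ψ) : Continuous (gradient ψ) := by
  rw [gradient_eq_toDual_symm]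
  exact (LinearIsometryEquiv.continuous _).comp (hψ.continuous_fderiv (by simp))

lemma hasCompactSupport_gradient (hc : HasCompactSupport ψ) :
    HasCompactSupport (gradient ψ) := by
  rw [gradient_eq_toDual_symm]
  exact (hc.fderiv ℝ).comp_left (map_zero _)

lemma tsupport_gradient_subset : tsupport (gradient ψ) ⊆ tsupport ψ := by
  refine closure_minimal (fun x hx => support_fderiv_subset ℝ (f := ψ) ?_) isClosed_closure
  rw [Function.mem_support] at hx ⊢
  intro h
  exact hx (by rw [gradient_eq_toDual_symm]; simp [h])

/-- The Cauchy–Schwarz inequality against the constant `1` on the unit interval. -/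
lemma sq_intervalIntegral_le {g : ℝ → ℝ} (hg : Continuous g) :
    (∫ s in (0 : ℝ)..1, g s) ^ 2 ≤ ∫ s in (0 : ℝ)..1, g s ^ 2 := by
  set c := ∫ s in (0 : ℝ)..1, g s
  have h : 0 ≤ ∫ s in (0 : ℝ)..1, (g s - c) ^ 2 :=
    intervalIntegral.integral_nonneg zero_le_one fun s _ => sq_nonneg _
  have e : ∫ s in (0 : ℝ)..1, (g s - c) ^ 2 = (∫ s in (0 : ℝ)..1, g s ^ 2) - c ^ 2 := by
    have e1 : ∀ s, (g s - c) ^ 2 = g s ^ 2 - 2 * c * g s + c ^ 2 := fun s => by ring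
    simp_rw [e1]
    rw [intervalIntegral.integral_add, intervalIntegral.integral_sub,
      intervalIntegral.integral_const_mul, intervalIntegral.integral_const]
    · simp only [sub_zero, one_smul]
      change _ - 2 * c * c + _ = _
      ring
    all_goals exact Continuous.intervalIntegrable (by fun_prop) _ _
  linarith

/-- The fundamental theorem of calculus along the segment from `x` to `x + z`. -/
lemma sq_sub_le_integral_gradient (hψ : ContDiff ℝ ∞ ψ) (x z : E d) :
    (ψ (x + z) - ψ x) ^ 2 ≤ ‖z‖ ^ 2 * ∫ s in (0 : ℝ)..1, ‖gradient ψ (x + s • z)‖ ^ 2 := by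
  have hgc := continuous_gradient hψ
  have hd : ∀ s : ℝ, HasDerivAt (fun s : ℝ => ψ (x + s • z))
      (inner ℝ (gradient ψ (x + s • z)) z) s := by
    intro s
    have h1 : HasDerivAt (fun s : ℝ => x + s • z) z s := by
      simpa using ((hasDerivAt_id s).smul_const z).const_add x
    have h2 := (hψ.differentiable (by simp) (x + s • z)).hasFDerivAt.comp_hasDerivAt s h1
    rwa [← inner_gradient_left] at h2
  have hcont : Continuous fun s : ℝ => inner ℝ (gradient ψ (x + s • z)) z := by fun_prop
  have hftc := intervalIntegral.integral_eq_sub_of_hasDerivAt (a := 0) (b := 1)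
    (fun s _ => hd s) (hcont.intervalIntegrable _ _)
  simp only [one_smul, zero_smul, add_zero] at hftc
  rw [← hftc, ← intervalIntegral.integral_const_mul]
  refine (sq_intervalIntegral_le hcont).trans ?_
  refine intervalIntegral.integral_mono_on zero_le_one
    ((hcont.pow 2).intervalIntegrable _ _)
    (Continuous.intervalIntegrable (by fun_prop) _ _) fun s _ => ?_
  rw [← mul_pow, mul_comm]
  exact sq_le_sq' (neg_le_of_abs_le (abs_real_inner_le_norm _ _)) (real_inner_le_norm _ _)

/-- A translation by `z` moves a test function by at most `‖z‖ ‖∇ψ‖` in `L²`. -/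
lemma lintegral_sq_translate_sub_le (hψ : ContDiff ℝ ∞ ψ) (z : E d) :
    ∫⁻ x, ENNReal.ofReal ((ψ (x + z) - ψ x) ^ 2) ≤
      ENNReal.ofReal (‖z‖ ^ 2) * ∫⁻ x, ENNReal.ofReal (‖gradient ψ x‖ ^ 2) := by
  have hgc := continuous_gradient hψ
  have h1 : ∀ x, ENNReal.ofReal ((ψ (x + z) - ψ x) ^ 2) ≤ ENNReal.ofReal (‖z‖ ^ 2) *
      ∫⁻ s in Set.Ioc (0 : ℝ) 1, ENNReal.ofReal (‖gradient ψ (x + s • z)‖ ^ 2) := by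
    intro x
    have hc : Continuous fun s : ℝ => ‖gradient ψ (x + s • z)‖ ^ 2 := by fun_prop
    rw [← ofReal_integral_eq_lintegral_ofReal
      (hc.integrableOn_Icc.mono_set Set.Ioc_subset_Icc_self)
      (Eventually.of_forall fun s => by positivity), ← ENNReal.ofReal_mul (by positivity),
      ← intervalIntegral.integral_of_le zero_le_one]
    exact ENNReal.ofReal_le_ofReal (sq_sub_le_integral_gradient hψ x z)
  refine (lintegral_mono h1).trans ?_
  have hm : Measurable fun p : E d × ℝ =>
      ENNReal.ofReal (‖gradient ψ (p.1 + p.2 • z)‖ ^ 2) :=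
    ENNReal.measurable_ofReal.comp (Continuous.measurable (by fun_prop))
  rw [lintegral_const_mul _ hm.lintegral_prod_right', lintegral_lintegral_swap hm.aemeasurable]
  have htrans : ∀ s : ℝ, ∫⁻ x, ENNReal.ofReal (‖gradient ψ (x + s • z)‖ ^ 2) =
      ∫⁻ x, ENNReal.ofReal (‖gradient ψ x‖ ^ 2) := fun s =>
    lintegral_add_right_eq_self (fun x => ENNReal.ofReal (‖gradient ψ x‖ ^ 2)) (s • z)
  simp only [htrans, setLIntegral_const]
  simp

/-- Poincaré's inequality: a translation by more than the diameter of the support separates the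
function from its translate. -/
lemma lintegral_sq_le_of_tsupport_subset_ball (hd : 0 < d) (hψ : ContDiff ℝ ∞ ψ) {R : ℝ}
    (hR : 0 < R) (hs : tsupport ψ ⊆ Metric.closedBall 0 R) :
    ∫⁻ x, ENNReal.ofReal (ψ x ^ 2) ≤
      ENNReal.ofReal ((3 * R) ^ 2) * ∫⁻ x, ENNReal.ofReal (‖gradient ψ x‖ ^ 2) := by
  set z : E d := EuclideanSpace.single ⟨0, hd⟩ (3 * R)
  have hz : ‖z‖ = 3 * R := by
    rw [PiLp.norm_single, Real.norm_eq_abs]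
    exact abs_of_pos (by positivity)
  rw [← hz]
  refine le_trans (lintegral_mono fun x => ENNReal.ofReal_le_ofReal ?_)
    (lintegral_sq_translate_sub_le hψ z)
  by_cases hx : ψ x = 0
  · rw [hx]; simpa using sq_nonneg (ψ (x + z))
  · have hxs : ‖x‖ ≤ R := by simpa using hs (subset_tsupport _ hx)
    have : ψ (x + z) = 0 := by
      by_contra hne
      have h1 : ‖x + z‖ ≤ R := by simpa using hs (subset_tsupport _ hne)
      have h2 : ‖z‖ ≤ ‖x + z‖ + ‖x‖ := by
        simpa using norm_sub_le (x + z) x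
      linarith
    simp [this]

/-- The index of the cube of side `h` of the standard grid that contains a point. -/
noncomputable def gridCell (h : ℝ) (x : E d) : Fin d → ℤ := fun i => ⌊x i / h⌋

/-- The cube with index `k` of the standard grid of side `h`. -/
noncomputable def gridCube (h : ℝ) (k : Fin d → ℤ) : Set (E d) := {x | gridCell h x = k}

lemma gridCube_eq_preimage {h : ℝ} (hh : 0 < h) (k : Fin d → ℤ) :
    gridCube h k = WithLp.ofLp ⁻¹'
      (Set.univ.pi fun i => Set.Ico ((k i : ℝ) * h) ((k i + 1 : ℝ) * h)) := by
  ext x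
  simp only [gridCube, gridCell, Set.mem_ofPred_eq, funext_iff, Set.mem_preimage, Set.mem_univ_pi,
    Set.mem_Ico, Int.floor_eq_iff, le_div_iff₀ hh, div_lt_iff₀ hh]

lemma measurableSet_gridCube {h : ℝ} (hh : 0 < h) (k : Fin d → ℤ) :
    MeasurableSet (gridCube h k) := by
  rw [gridCube_eq_preimage hh]
  exact (PiLp.volume_preserving_ofLp (Fin d)).measurable
    (MeasurableSet.univ_pi fun i => measurableSet_Ico)

lemma volume_gridCube {h : ℝ} (hh : 0 < h) (k : Fin d → ℤ) :
    volume (gridCube h k) = ENNReal.ofReal (h ^ d) := by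
  rw [gridCube_eq_preimage hh, (PiLp.volume_preserving_ofLp (Fin d)).measure_preimage
    (MeasurableSet.univ_pi fun i => measurableSet_Ico).nullMeasurableSet, Real.volume_pi_Ico]
  simp [add_mul, ENNReal.ofReal_pow hh.le]

lemma dist_le_of_mem_gridCube {h : ℝ} (hh : 0 < h) {k : Fin d → ℤ} {x y : E d}
    (hx : x ∈ gridCube h k) (hy : y ∈ gridCube h k) : ‖y - x‖ ≤ √d * h := by
  rw [gridCube_eq_preimage hh] at hx hy
  simp only [Set.mem_preimage, Set.mem_univ_pi, Set.mem_Ico] at hx hy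
  refine abs_le_of_sq_le_sq' ?_ (by positivity) |>.2
  rw [EuclideanSpace.norm_sq_eq, mul_pow, Real.sq_sqrt (Nat.cast_nonneg d)]
  refine (Finset.sum_le_card_nsmul _ _ (h ^ 2) fun i _ => ?_).trans (by simp)
  have h1 := hx i
  have h2 := hy i
  rw [Real.norm_eq_abs, sq_abs, PiLp.sub_apply]
  refine sq_le_sq' ?_ ?_ <;> nlinarith

lemma finite_setOf_gridCube_inter_ball {h : ℝ} (hh : 0 < h) (R : ℝ) :
    {k : Fin d → ℤ | (gridCube h k ∩ Metric.closedBall 0 R).Nonempty}.Finite := by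
  refine (Set.finite_Icc (fun _ : Fin d => ⌊-R / h⌋) (fun _ => ⌊R / h⌋)).subset ?_
  rintro k ⟨x, rfl, hx⟩
  have hx' : ∀ i, |x i| ≤ R := fun i => by
    rw [← Real.norm_eq_abs]
    exact (PiLp.norm_apply_le x i).trans (by simpa using hx)
  constructor <;> intro i <;> refine Int.floor_le_floor (div_le_div_of_nonneg_right ?_ hh.le)
  · exact (abs_le.1 (hx' i)).1
  · exact (abs_le.1 (hx' i)).2

/-- The mean square on a set of finite volume is the square of the mean plus the variance, the
latter written as a double integral. -/
lemma setIntegral_sq_eq {μ : Measure (E d)} {Q : Set (E d)} {v : ℝ} (hv : 0 < v)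
    (hQ : μ Q = ENNReal.ofReal v) (h1 : IntegrableOn ψ Q μ) (h2 : IntegrableOn (fun x => ψ x ^ 2) Q μ) :
    ENNReal.ofReal (∫ x in Q, ψ x ^ 2 ∂μ) = ENNReal.ofReal (v⁻¹ * (∫ x in Q, ψ x ∂μ) ^ 2) +
      ENNReal.ofReal (2 * v)⁻¹ *
        ∫⁻ x in Q, ∫⁻ y in Q, ENNReal.ofReal ((ψ x - ψ y) ^ 2) ∂μ ∂μ := by
  set I := ∫ x in Q, ψ x ∂μ
  set J := ∫ x in Q, ψ x ^ 2 ∂μ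
  have hfin : IsFiniteMeasure (μ.restrict Q) := ⟨by rw [Measure.restrict_apply_univ, hQ]; simp⟩
  have hreal : (μ.restrict Q).real Set.univ = v := by
    rw [Measure.real, Measure.restrict_apply_univ, hQ, ENNReal.toReal_ofReal hv.le]
  have key : ∀ a b c : ℝ, Integrable (fun y => a * ψ y ^ 2 - b * ψ y + c) (μ.restrict Q) ∧
      ∫ y in Q, (a * ψ y ^ 2 - b * ψ y + c) ∂μ = a * J - b * I + v * c := fun a b c => by
    have i1 : Integrable (fun y => a * ψ y ^ 2 - b * ψ y) (μ.restrict Q) :=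
      (h2.const_mul _).sub (h1.const_mul _)
    refine ⟨i1.add (integrable_const c), ?_⟩
    rw [integral_add i1 (integrable_const c), integral_sub (h2.const_mul _) (h1.const_mul _),
      integral_const_mul, integral_const_mul, integral_const, hreal, smul_eq_mul]
  have e1 : ∀ x y, (ψ x - ψ y) ^ 2 = 1 * ψ y ^ 2 - 2 * ψ x * ψ y + ψ x ^ 2 :=
    fun x y => by ring
  have hin : ∀ x, ∫ y in Q, (ψ x - ψ y) ^ 2 ∂μ = v * ψ x ^ 2 - 2 * I * ψ x + J := fun x => by
    simp_rw [e1]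
    rw [(key _ _ _).2]
    ring
  have s1 : ∀ x, ∫⁻ y in Q, ENNReal.ofReal ((ψ x - ψ y) ^ 2) ∂μ =
      ENNReal.ofReal (v * ψ x ^ 2 - 2 * I * ψ x + J) := fun x => by
    rw [← hin, ofReal_integral_eq_lintegral_ofReal _ (Eventually.of_forall fun _ => sq_nonneg _)]
    simp_rw [e1]
    exact (key _ _ _).1
  have hnn : ∀ x, 0 ≤ v * ψ x ^ 2 - 2 * I * ψ x + J := fun x => by
    rw [← hin]; exact integral_nonneg fun _ => sq_nonneg _
  simp_rw [s1]
  rw [← ofReal_integral_eq_lintegral_ofReal (key _ _ _).1 (Eventually.of_forall hnn),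
    ← ENNReal.ofReal_mul (by positivity), ← ENNReal.ofReal_add
    (by positivity) (mul_nonneg (by positivity) (integral_nonneg hnn)), (key _ _ _).2]
  congr 1
  change J = v⁻¹ * I ^ 2 + (2 * v)⁻¹ * (v * J - 2 * I * I + v * J)
  field_simp
  ring

/-- The local variances on the cubes of side `h` add up to at most a multiple of `h² ‖∇ψ‖²`:
two points of one cube differ by a vector of length at most `√d h`. -/
lemma sum_gridCube_variance_le (hψ : ContDiff ℝ ∞ ψ) {h : ℝ} (hh : 0 < h)
    (F : Finset (Fin d → ℤ)) :
    ∑ k ∈ F, ∫⁻ x in gridCube h k, ∫⁻ y in gridCube h k, ENNReal.ofReal ((ψ x - ψ y) ^ 2) ≤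
      volume (Metric.closedBall (0 : E d) (√d * h)) * (ENNReal.ofReal ((√d * h) ^ 2) *
        ∫⁻ x, ENNReal.ofReal (‖gradient ψ x‖ ^ 2)) := by
  have hc := hψ.continuous
  set B := Metric.closedBall (0 : E d) (√d * h)
  have hm : Measurable fun p : E d × E d => ENNReal.ofReal ((ψ (p.1 + p.2) - ψ p.1) ^ 2) :=
    ENNReal.measurable_ofReal.comp (Continuous.measurable (by fun_prop))
  have h1 : ∀ k ∈ F, ∫⁻ x in gridCube h k, ∫⁻ y in gridCube h k,
      ENNReal.ofReal ((ψ x - ψ y) ^ 2) ≤ ∫⁻ x in gridCube h k, ∫⁻ z in B,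
      ENNReal.ofReal ((ψ (x + z) - ψ x) ^ 2) := by
    intro k _
    refine setLIntegral_mono' (measurableSet_gridCube hh k) fun x hx => ?_
    rw [← lintegral_indicator (measurableSet_gridCube hh k),
      ← lintegral_indicator Metric.isClosed_closedBall.measurableSet,
      ← lintegral_add_left_eq_self _ x]
    -- substitute `y = x + z`
    refine lintegral_mono fun z => ?_
    by_cases hz : x + z ∈ gridCube h k
    · have hzB : z ∈ B := by simpa [B] using dist_le_of_mem_gridCube hh hx hz
      rw [Set.indicator_of_mem hz, Set.indicator_of_mem hzB, ← neg_sub (ψ (x + z)), neg_sq]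
    · rw [Set.indicator_of_notMem hz]; exact zero_le
  refine (Finset.sum_le_sum h1).trans ?_
  rw [← lintegral_biUnion_finset (fun i _ j _ hij => ?_) fun k _ => measurableSet_gridCube hh k]
  · refine (setLIntegral_le_lintegral _ _).trans ?_
    rw [lintegral_lintegral_swap hm.aemeasurable]
    refine (setLIntegral_mono' Metric.isClosed_closedBall.measurableSet
      (g := fun _ => ENNReal.ofReal ((√d * h) ^ 2) *
        ∫⁻ x, ENNReal.ofReal (‖gradient ψ x‖ ^ 2)) fun z hz => ?_).trans ?_
    · refine (lintegral_sq_translate_sub_le hψ z).trans ?_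
      gcongr
      simpa [B] using hz
    · rw [setLIntegral_const, mul_comm]
  · rw [Function.onFun, Set.disjoint_left]
    rintro x rfl hxj
    exact hij hxj

end BackwardHeat

namespace BackwardHeat

/-! ### The space `H₀¹(Ω)`: Poincaré inequality and compact embedding -/

lemma ofReal_norm_sq_eq_lintegral {X F : Type*} [MeasurableSpace X] {μ : Measure X}
    [NormedAddCommGroup F] [InnerProductSpace ℝ F] (f : Lp F 2 μ) :
    ENNReal.ofReal (‖f‖ ^ 2) = ∫⁻ x, ENNReal.ofReal (‖f x‖ ^ 2) ∂μ := by
  have hi := L2.integrable_inner (𝕜 := ℝ) f f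
  rw [← real_inner_self_eq_norm_sq, L2.inner_def]
  simp only [real_inner_self_eq_norm_sq] at hi ⊢
  exact ofReal_integral_eq_lintegral_ofReal hi (Eventually.of_forall fun _ => sq_nonneg _)

variable {d : ℕ} {Ω : Set (E d)}

lemma ofReal_norm_sq_eq_of_ae_eq {F : Type*} [NormedAddCommGroup F] [InnerProductSpace ℝ F]
    {f : Lp F 2 (volume.restrict Ω)} {g : E d → F}
    (hf : ∀ᵐ x ∂(volume.restrict Ω), f x = g x) (hg : tsupport g ⊆ Ω) :
    ENNReal.ofReal (‖f‖ ^ 2) = ∫⁻ x, ENNReal.ofReal (‖g x‖ ^ 2) := by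
  rw [ofReal_norm_sq_eq_lintegral, ← setLIntegral_eq_of_support_subset (s := Ω)
    (f := fun x => ENNReal.ofReal (‖g x‖ ^ 2))]
  · refine lintegral_congr_ae ?_
    filter_upwards [hf] with x hx
    rw [hx]
  · intro x hx
    refine hg (subset_tsupport _ ?_)
    rw [Function.mem_support] at hx ⊢
    rintro h
    simp [h] at hx

lemma ofReal_norm_sq_fst {w : L2 Ω × L2Vec Ω} {ψ : E d → ℝ} (hs : tsupport ψ ⊆ Ω)
    (h1 : ∀ᵐ x ∂(volume.restrict Ω), w.1 x = ψ x) :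
    ENNReal.ofReal (‖w.1‖ ^ 2) = ∫⁻ x, ENNReal.ofReal (ψ x ^ 2) := by
  simpa using! ofReal_norm_sq_eq_of_ae_eq h1 hs

lemma ofReal_norm_sq_snd {w : L2 Ω × L2Vec Ω} {ψ : E d → ℝ} (hs : tsupport ψ ⊆ Ω)
    (h2 : ∀ᵐ x ∂(volume.restrict Ω), w.2 x = gradient ψ x) :
    ENNReal.ofReal (‖w.2‖ ^ 2) = ∫⁻ x, ENNReal.ofReal (‖gradient ψ x‖ ^ 2) :=
  ofReal_norm_sq_eq_of_ae_eq h2 (tsupport_gradient_subset.trans hs)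

lemma exists_subset_closedBall (hΩb : Bornology.IsBounded Ω) :
    ∃ R : ℝ, 0 < R ∧ Ω ⊆ Metric.closedBall 0 R := by
  obtain ⟨R, hR⟩ := hΩb.subset_closedBall 0
  exact ⟨max R 1, by positivity, hR.trans (Metric.closedBall_subset_closedBall (le_max_left _ _))⟩

/-- Poincaré's inequality on `H₀¹(Ω)`. -/
lemma exists_poincare (hd : 0 < d) (hΩb : Bornology.IsBounded Ω) :
    ∃ C : ℝ, 0 < C ∧ ∀ w ∈ sobolevGraph Ω, ‖w.1‖ ^ 2 ≤ C * ‖w.2‖ ^ 2 := by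
  obtain ⟨R, hR, hΩR⟩ := exists_subset_closedBall hΩb
  refine ⟨(3 * R) ^ 2, by positivity, fun w hw => ?_⟩
  refine closure_minimal (s := testGraph Ω)
    (t := {w | ‖w.1‖ ^ 2 ≤ (3 * R) ^ 2 * ‖w.2‖ ^ 2}) ?_
    (isClosed_le (by fun_prop) (by fun_prop)) hw
  rintro w ⟨ψ, hψ, -, hs, h1, h2⟩
  have h := lintegral_sq_le_of_tsupport_subset_ball hd hψ hR (hs.trans hΩR)
  rw [← ofReal_norm_sq_fst hs h1, ← ofReal_norm_sq_snd hs h2,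
    ← ENNReal.ofReal_mul (by positivity)] at h
  exact (ENNReal.ofReal_le_ofReal_iff (by positivity)).1 h

lemma setIntegral_restrict_eq {f : L2 Ω} {ψ : E d → ℝ} (hs : tsupport ψ ⊆ Ω)
    (hf : ∀ᵐ x ∂(volume.restrict Ω), f x = ψ x) {Q : Set (E d)} (hQ : MeasurableSet Q) :
    ∫ x in Q, f x ∂(volume.restrict Ω) = ∫ x in Q, ψ x := by
  have e1 : ∫ x in Q, f x ∂(volume.restrict Ω) = ∫ x in Q, ψ x ∂(volume.restrict Ω) :=
    integral_congr_ae (ae_restrict_of_ae hf)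
  rw [e1, Measure.restrict_restrict hQ]
  refine (setIntegral_eq_of_subset_of_forall_sdiff_eq_zero hQ Set.inter_subset_left
    fun x hx => ?_).symm
  by_contra hne
  exact hx.2 ⟨hx.1, hs (subset_tsupport _ hne)⟩

/-- The functional `f ↦ c ∫_Q f` is represented by a vector of `L²(Ω)`. -/
lemma exists_inner_eq_setIntegral (hΩb : Bornology.IsBounded Ω) {Q : Set (E d)}
    (hQ : MeasurableSet Q) (c : ℝ) :
    ∃ a : L2 Ω, ∀ (f : L2 Ω) (ψ : E d → ℝ), tsupport ψ ⊆ Ω →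
      (∀ᵐ x ∂(volume.restrict Ω), f x = ψ x) → inner ℝ a f = c * ∫ x in Q, ψ x := by
  have hfin : IsFiniteMeasure (volume.restrict Ω) :=
    ⟨by rw [Measure.restrict_apply_univ]; exact hΩb.measure_lt_top⟩
  refine ⟨indicatorConstLp 2 hQ (measure_ne_top _ _) c, fun f ψ hs hf => ?_⟩
  rw [← setIntegral_restrict_eq hs hf hQ]
  refine (L2.inner_indicatorConstLp_eq_inner_setIntegral ℝ hQ _ c f).trans ?_
  simp [mul_comm]

/-- The inequality behind the Rellich–Kondrachov theorem: on a grid of small cubes, the `L²` norm of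
a function is controlled by finitely many averages and a small multiple of its gradient. -/
lemma exists_finite_averages (hΩb : Bornology.IsBounded Ω) {ε : ℝ} (hε : 0 < ε) :
    ∃ (F : Finset (Fin d → ℤ)) (a : (Fin d → ℤ) → L2 Ω), ∀ w ∈ sobolevGraph Ω,
      ‖w.1‖ ^ 2 ≤ ∑ k ∈ F, inner ℝ (a k) w.1 ^ 2 + ε * ‖w.2‖ ^ 2 := by
  obtain ⟨R, hR, hΩR⟩ := exists_subset_closedBall hΩb
  -- the volume of the ball of radius `√d h` is `c h ^ d`
  obtain ⟨c, hc, hvol⟩ : ∃ c : ℝ, 0 ≤ c ∧ ∀ h : ℝ, 0 < h →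
      volume (Metric.closedBall (0 : E d) (√d * h)) = ENNReal.ofReal (c * h ^ d) := by
    refine ⟨√d ^ d * (volume (Metric.ball (0 : E d) 1)).toReal, by positivity, fun h hh => ?_⟩
    rw [Measure.addHaar_closedBall _ _ (by positivity), finrank_euclideanSpace_fin,
      mul_right_comm, ENNReal.ofReal_mul (by positivity),
      ENNReal.ofReal_toReal measure_ball_lt_top.ne, mul_pow]
  obtain ⟨h, hh, hhε⟩ : ∃ h : ℝ, 0 < h ∧ c * d / 2 * h ^ 2 ≤ ε := by
    have h1 : Tendsto (fun h : ℝ => c * d / 2 * h ^ 2) (𝓝[>] 0) (𝓝 0) := by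
      have : Continuous fun h : ℝ => c * d / 2 * h ^ 2 := by fun_prop
      simpa using (this.tendsto 0).mono_left nhdsWithin_le_nhds
    obtain ⟨h, h2, h3⟩ := ((h1.eventually_le_const hε).and self_mem_nhdsWithin).exists
    exact ⟨h, h3, h2⟩
  -- `v` is the volume of a cube; normalising by `√v` makes the squared averages sum up correctly
  set v := h ^ d with hv
  have hv0 : 0 < v := by positivity
  set F := (finite_setOf_gridCube_inter_ball (d := d) hh R).toFinset
  choose a ha using fun k : Fin d → ℤ =>
    exists_inner_eq_setIntegral hΩb (measurableSet_gridCube hh k) (√v)⁻¹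
  refine ⟨F, a, fun w hw => ?_⟩
  refine closure_minimal (s := testGraph Ω)
    (t := {w | ‖w.1‖ ^ 2 ≤ ∑ k ∈ F, inner ℝ (a k) w.1 ^ 2 + ε * ‖w.2‖ ^ 2}) ?_
    (isClosed_le (by fun_prop) (by fun_prop)) hw
  rintro w ⟨ψ, hψ, hψc, hs, h1, h2⟩
  have hint : Integrable ψ := hψ.continuous.integrable_of_hasCompactSupport hψc
  have hint2 : Integrable fun x => ψ x ^ 2 := by
    simp_rw [sq]
    exact (hψ.continuous.mul hψ.continuous).integrable_of_hasCompactSupport hψc.mul_left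
  have hzero : ∀ x, x ∉ Ω → ψ x = 0 := fun x hx => by
    by_contra hne
    exact hx (hs (subset_tsupport _ hne))
  have hinner : ∀ k, inner ℝ (a k) w.1 ^ 2 = v⁻¹ * (∫ x in gridCube h k, ψ x) ^ 2 := fun k => by
    rw [ha k w.1 ψ hs h1, mul_pow, inv_pow, Real.sq_sqrt hv0.le]
  simp only [Set.mem_ofPred_eq, hinner]
  have hcover : ∫⁻ x, ENNReal.ofReal (ψ x ^ 2) ≤
      ∑ k ∈ F, ENNReal.ofReal (∫ x in gridCube h k, ψ x ^ 2) := by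
    rw [← setLIntegral_eq_of_support_subset (s := ⋃ k ∈ F, gridCube h k)]
    · rw [lintegral_biUnion_finset _ fun k _ => measurableSet_gridCube hh k]
      · refine Finset.sum_le_sum fun k _ => ?_
        rw [ofReal_integral_eq_lintegral_ofReal hint2.integrableOn
          (Eventually.of_forall fun _ => sq_nonneg _)]
      · intro i _ j _ hij
        rw [Function.onFun, Set.disjoint_left]
        rintro x rfl hxj
        exact hij hxj
    · intro x hx
      have hxΩ : x ∈ Ω := by
        by_contra hne
        simp [hzero x hne] at hx
      exact Set.mem_biUnion (x := gridCell h x)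
        ((Set.Finite.mem_toFinset _).2 ⟨x, rfl, hΩR hxΩ⟩) rfl
  -- on each cube, split the mean square into squared mean and variance
  have hvar := sum_gridCube_variance_le hψ hh F
  have hdec : ∀ k ∈ F, ENNReal.ofReal (∫ x in gridCube h k, ψ x ^ 2) = _ := fun k _ =>
    setIntegral_sq_eq hv0 (volume_gridCube hh k) hint.integrableOn hint2.integrableOn
  rw [Finset.sum_congr rfl hdec, Finset.sum_add_distrib, ← Finset.mul_sum] at hcover
  have htot := hcover.trans (add_le_add_right (mul_le_mul_right hvar _) _)
  rw [← ofReal_norm_sq_fst hs h1, ← ofReal_norm_sq_snd hs h2, hvol h hh,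
    ← ENNReal.ofReal_sum_of_nonneg fun k _ => by positivity, ← ENNReal.ofReal_mul (by positivity),
    ← ENNReal.ofReal_mul (by positivity), ← ENNReal.ofReal_mul (by positivity),
    ← ENNReal.ofReal_add (Finset.sum_nonneg fun k _ => by positivity) (by positivity),
    ENNReal.ofReal_le_ofReal_iff (add_nonneg (Finset.sum_nonneg fun k _ => by positivity)
      (by positivity))] at htot
  refine htot.trans (add_le_add_right ?_ _)
  rw [mul_pow, Real.sq_sqrt (Nat.cast_nonneg d)]
  calc (2 * v)⁻¹ * (c * h ^ d * (d * h ^ 2 * ‖w.2‖ ^ 2)) = (c * d / 2 * h ^ 2) * ‖w.2‖ ^ 2 := by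
        rw [← hv]; field_simp
    _ ≤ ε * ‖w.2‖ ^ 2 := by gcongr

end BackwardHeat

namespace BackwardHeat

/-! ### Compact operators and eigenbases in Hilbert spaces -/

lemma countable_of_orthonormal {H : Type*} [NormedAddCommGroup H] [InnerProductSpace ℝ H]
    [TopologicalSpace.SeparableSpace H] {ι : Type*} {v : ι → H}
    (hv : Orthonormal ℝ v) : Countable ι := by
  -- the balls of radius `1 / 2` about the vectors are disjoint
  refine Pairwise.countable_of_isOpen_disjoint (s := fun i => Metric.ball (v i) (1 / 2))
    (fun i j hij => ?_) (fun i => Metric.isOpen_ball) fun i => Metric.nonempty_ball.2 (by norm_num)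
  refine Metric.ball_disjoint_ball ?_
  have h1 : ‖v i - v j‖ ^ 2 = 2 := by
    rw [norm_sub_sq_real, hv.1 i, hv.1 j, hv.2 hij]; norm_num
  rw [dist_eq_norm]
  nlinarith [norm_nonneg (v i - v j)]

variable {H H' : Type*} [NormedAddCommGroup H] [InnerProductSpace ℝ H] [CompleteSpace H]
  [NormedAddCommGroup H'] [InnerProductSpace ℝ H'] [CompleteSpace H']

/-- An operator that is small on the common kernel of finitely many functionals of its values is
compact: it is close to its restriction to the finite-dimensional complement. -/
lemma isCompactOperator_of_small_on_finite_codim {κ : Type*} (S : H →L[ℝ] H')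
    (h : ∀ ε > 0, ∃ (F : Finset κ) (a : κ → H'), ∀ x : H,
      (∀ k ∈ F, inner ℝ (a k) (S x) = 0) → ‖S x‖ ≤ ε * ‖x‖) :
    IsCompactOperator S := by
  refine isClosed_setOfPred_isCompactOperator.closure_subset
    (Metric.mem_closure_iff.2 fun ε hε => ?_)
  obtain ⟨F, a, hFa⟩ := h (ε / 2) (half_pos hε)
  -- on `Kᗮ` the functionals of `S x` vanish
  set K : Submodule ℝ H := Submodule.span ℝ ((fun k => S.adjoint (a k)) '' (F : Set κ)) with hK
  have : FiniteDimensional ℝ K := FiniteDimensional.span_of_finite ℝ (F.finite_toSet.image _)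
  have hcomp : IsCompactOperator ((S ∘L K.subtypeL) ∘L K.orthogonalProjectionOnto) :=
    (isCompactOperator_of_locallyCompactSpace_dom K.orthogonalProjectionOnto).clm_comp
      (S ∘L K.subtypeL)
  refine ⟨_, hcomp, ?_⟩
  rw [dist_eq_norm]
  refine lt_of_le_of_lt (ContinuousLinearMap.opNorm_le_bound _ (half_pos hε).le fun x => ?_)
    (half_lt_self hε)
  have hx : (S - (S ∘L K.subtypeL) ∘L K.orthogonalProjectionOnto) x =
      S (x - K.starProjection x) := by
    rw [map_sub]; rfl
  rw [hx]
  refine (hFa _ fun k hk => ?_).trans ?_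
  · rw [← ContinuousLinearMap.adjoint_inner_left]
    have hmem : S.adjoint (a k) ∈ K := Submodule.subset_span ⟨k, hk, rfl⟩
    exact Submodule.inner_right_of_mem_orthogonal hmem (K.sub_starProjection_mem_orthogonal x)
  · gcongr
    rw [← Submodule.starProjection_orthogonal_val]
    exact Submodule.norm_starProjection_apply_le _ _

/-- The spectral theorem: a compact symmetric operator on an infinite-dimensional separable Hilbert
space has a Hilbert basis of eigenvectors, indexed by `ℕ`. -/
lemma exists_hilbertBasis_eigenvectors [TopologicalSpace.SeparableSpace H]
    (hH : ¬ FiniteDimensional ℝ H) {S : H →L[ℝ] H} (hS : IsCompactOperator S)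
    (hS' : S.IsSymmetric) :
    ∃ (φ : HilbertBasis ℕ ℝ H) (μ : ℕ → ℝ), ∀ n, S (φ n) = μ n • φ n := by
  have hcl : ∀ μ : ℝ, CompleteSpace (Module.End.eigenspace (S : Module.End ℝ H) μ) := fun μ => by
    have : IsClosed ((Module.End.eigenspace (S : Module.End ℝ H) μ : Submodule ℝ H) : Set H) := by
      have e : ((Module.End.eigenspace (S : Module.End ℝ H) μ : Submodule ℝ H) : Set H) =
          {x | S x = μ • x} := by
        ext x; exact Module.End.mem_eigenspace_iff
      rw [e]
      exact isClosed_eq (by fun_prop) (by fun_prop)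
    exact this.completeSpace_coe
  -- collect orthonormal bases of all eigenspaces
  choose w b hb using fun μ : ℝ =>
    exists_hilbertBasis ℝ (Module.End.eigenspace (S : Module.End ℝ H) μ)
  set ι := Σ μ : ℝ, w μ
  set v : ι → H := fun i => (b i.1 i.2 : H)
  have hon : Orthonormal ℝ v := hS'.orthogonalFamily_eigenspaces.orthonormal_sigma_orthonormal
    fun μ => (b μ).orthonormal
  have hv : ∀ i : ι, S (v i) = i.1 • v i := fun i =>
    Module.End.mem_eigenspace_iff.1 (b i.1 i.2).2
  have hbot : (Submodule.span ℝ (Set.range v))ᗮ = ⊥ := by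
    rw [eq_bot_iff, ← S.orthogonalComplement_iSup_eigenspaces_eq_bot hS hS',
      ← Submodule.iInf_orthogonal]
    refine fun x hx => (Submodule.mem_iInf _).2 fun μ => ?_
    rw [Submodule.mem_orthogonal]
    intro u hu
    have h1 : ∀ i : w μ, inner ℝ (b μ i : H) x = 0 := fun i =>
      Submodule.inner_right_of_mem_orthogonal
        (Submodule.subset_span (Set.mem_range_self (f := v) ⟨μ, i⟩)) hx
    have h2 := ((b μ).hasSum_repr ⟨u, hu⟩).mapL
      (((innerSL ℝ x) ∘L (Module.End.eigenspace (S : Module.End ℝ H) μ).subtypeL))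
    have h3 : ∀ i : w μ, ((innerSL ℝ x) ∘L (Module.End.eigenspace (S : Module.End ℝ H) μ).subtypeL)
        ((b μ).repr ⟨u, hu⟩ i • b μ i) = 0 := fun i => by
      simp [← real_inner_comm x, h1]
    simp only [h3] at h2
    rw [real_inner_comm]
    exact h2.unique hasSum_zero
  have : Countable ι := countable_of_orthonormal hon
  have : Infinite ι := by
    by_contra hfin
    rw [not_infinite_iff_finite] at hfin
    have := Fintype.ofFinite ι
    exact hH (HilbertBasis.mkOfOrthogonalEqBot hon hbot).toOrthonormalBasis.toBasis.finiteDimensional_of_finite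
  obtain ⟨e⟩ := nonempty_equiv_of_countable (α := ℕ) (β := ι)
  have hbot' : (Submodule.span ℝ (Set.range (v ∘ e)))ᗮ = ⊥ := by
    rwa [e.surjective.range_comp]
  refine ⟨HilbertBasis.mkOfOrthogonalEqBot (hon.comp e e.injective) hbot', fun n => (e n).1,
    fun n => ?_⟩
  rw [HilbertBasis.coe_mkOfOrthogonalEqBot]
  exact hv (e n)

/-- Indicators of infinitely many disjoint open sets show that `L²` is infinite-dimensional. -/
lemma not_finiteDimensional_Lp {X : Type*} [TopologicalSpace X] [T2Space X] [MeasurableSpace X]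
    [BorelSpace X] {μ : Measure X} [μ.IsOpenPosMeasure] {U : Set X} (hU : IsOpen U)
    (hinf : U.Infinite) (hμ : μ U ≠ ⊤) : ¬ FiniteDimensional ℝ (Lp ℝ 2 (μ.restrict U)) := by
  have : Infinite U := hinf.to_subtype
  obtain ⟨W, hWinf, hWo, hWd⟩ := exists_seq_infinite_isOpen_pairwise_disjoint U
  have hfin : IsFiniteMeasure (μ.restrict U) :=
    ⟨by rw [Measure.restrict_apply_univ]; exact hμ.lt_top⟩
  set Y : ℕ → Set X := fun n => Subtype.val '' W n
  have hYo : ∀ n, IsOpen (Y n) := fun n => hU.isOpenMap_subtype_val _ (hWo n)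
  have hYU : ∀ n, Y n ⊆ U := fun n => by rintro _ ⟨x, -, rfl⟩; exact x.2
  have hYd : ∀ i j, i ≠ j → Disjoint (Y i) (Y j) := fun i j hij =>
    Set.disjoint_image_of_injective Subtype.val_injective (hWd hij)
  set f : ℕ → Lp ℝ 2 (μ.restrict U) := fun n =>
    indicatorConstLp 2 (hYo n).measurableSet (measure_ne_top _ _) 1
  have hf : ∀ i j, inner ℝ (f i) (f j) = (μ.restrict U).real (Y i ∩ Y j) := fun i j => by
    have h1 := L2.inner_indicatorConstLp_eq_inner_setIntegral (μ := μ.restrict U) ℝ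
      (hYo i).measurableSet (measure_ne_top _ _) (1 : ℝ) (f j)
    refine h1.trans ?_
    have h2 : ∫ x in Y i, f j x ∂(μ.restrict U) =
        ∫ x in Y i, (Y j).indicator (fun _ => (1 : ℝ)) x ∂(μ.restrict U) :=
      integral_congr_ae (ae_restrict_of_ae indicatorConstLp_coeFn)
    rw [h2, setIntegral_indicator (hYo j).measurableSet]
    simp
  have hli : LinearIndependent ℝ f := by
    refine linearIndependent_of_ne_zero_of_inner_eq_zero (𝕜 := ℝ) (fun i h0 => ?_)
      fun i j hij => ?_
    · have h1 := hf i i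
      rw [h0, inner_zero_left, Set.inter_self, measureReal_def,
        Measure.restrict_apply (hYo i).measurableSet, Set.inter_eq_left.2 (hYU i), eq_comm,
        ENNReal.toReal_eq_zero_iff] at h1
      rcases h1 with h1 | h1
      · exact ((hYo i).measure_pos μ ((hWinf i).nonempty.image _)).ne' h1
      · exact ((measure_mono (hYU i)).trans_lt hμ.lt_top).ne h1
    · change inner ℝ (f i) (f j) = 0
      rw [hf, (hYd i j hij).inter_eq]; simp
  intro hfd
  exact not_finite_iff_infinite.2 inferInstance hli.finite

end BackwardHeat

namespace BackwardHeat

/-! ### The solution operator of the Dirichlet problem and its eigensystems -/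

variable {d : ℕ} {Ω : Set (E d)}

/-- `testGraph Ω` as a linear subspace. -/
noncomputable def testSubmodule (Ω : Set (E d)) : Submodule ℝ (L2 Ω × L2Vec Ω) where
  carrier := testGraph Ω
  zero_mem' := by
    refine ⟨0, contDiff_const, HasCompactSupport.zero, by simp [tsupport], ?_, ?_⟩
    · filter_upwards [Lp.coeFn_zero ℝ 2 (volume.restrict Ω)] with x hx using hx
    · filter_upwards [Lp.coeFn_zero (E d) 2 (volume.restrict Ω)] with x hx
      rw [gradient_eq_toDual_symm]
      refine hx.trans ?_
      simp
  add_mem' := by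
    rintro v w ⟨ψ, hψ, hψc, hψs, h1, h2⟩ ⟨χ, hχ, hχc, hχs, h3, h4⟩
    refine ⟨ψ + χ, hψ.add hχ, hψc.add hχc,
      (tsupport_add ψ χ).trans (Set.union_subset hψs hχs), ?_, ?_⟩
    · filter_upwards [h1, h3, Lp.coeFn_add v.1 w.1] with x e1 e3 e
      refine e.trans ?_
      simp [e1, e3]
    · filter_upwards [h2, h4, Lp.coeFn_add v.2 w.2] with x e1 e3 e
      refine e.trans ?_
      rw [Pi.add_apply, e1, e3]
      simp only [gradient_eq_toDual_symm]
      rw [fderiv_add (hψ.differentiable (by simp) x)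
        (hχ.differentiable (by simp) x), map_add]
  smul_mem' := by
    rintro c w ⟨ψ, hψ, hψc, hψs, h1, h2⟩
    refine ⟨fun x => c * ψ x, contDiff_const.mul hψ, hψc.mul_left,
      (tsupport_mul_subset_right).trans hψs, ?_, ?_⟩
    · filter_upwards [h1, Lp.coeFn_smul c w.1] with x e1 e
      refine e.trans ?_
      simp [e1]
    · filter_upwards [h2, Lp.coeFn_smul c w.2] with x e1 e
      refine e.trans ?_
      rw [Pi.smul_apply, e1]
      simp only [gradient_eq_toDual_symm]
      rw [fderiv_const_mul (hψ.differentiable (by simp) x), map_smul]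

/-- The weak formulation extends from test functions to `H₀¹(Ω)`. -/
lemma inner_eq_of_mem_sobolevGraph {p : L2Vec Ω} {f : L2 Ω}
    (h : ∀ w ∈ testGraph Ω, inner ℝ p w.2 = inner ℝ f w.1) :
    ∀ w ∈ sobolevGraph Ω, inner ℝ p w.2 = inner ℝ f w.1 := fun w hw =>
  closure_minimal (s := testGraph Ω) (t := {w | inner ℝ p w.2 = inner ℝ f w.1}) h
    (isClosed_eq (by fun_prop) (by fun_prop)) hw

/-- Test functions are dense in `L²(Ω)`: only `0` is orthogonal to all of them. -/
lemma eq_zero_of_forall_testGraph (hΩo : IsOpen Ω) (hΩb : Bornology.IsBounded Ω) {f : L2 Ω}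
    (h : ∀ w ∈ testGraph Ω, inner ℝ f w.1 = 0) : f = 0 := by
  have hfin : IsFiniteMeasure (volume.restrict Ω) :=
    ⟨by rw [Measure.restrict_apply_univ]; exact hΩb.measure_lt_top⟩
  have hint : IntegrableOn f Ω := (Lp.memLp f).integrable (by norm_num)
  have h0 := hΩo.ae_eq_zero_of_integral_contDiff_smul_eq_zero hint.locallyIntegrableOn
    fun ψ hψ hψc hψs => ?_
  · rw [Lp.ext_iff]
    filter_upwards [(ae_restrict_iff' hΩo.measurableSet).2 h0, Lp.coeFn_zero ℝ 2
      (volume.restrict Ω)] with x h1 h2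
    rw [h1, h2]; rfl
  · have m1 : MemLp ψ 2 (volume.restrict Ω) :=
      hψ.continuous.memLp_of_hasCompactSupport hψc
    have m2 : MemLp (gradient ψ) 2 (volume.restrict Ω) :=
      (continuous_gradient hψ).memLp_of_hasCompactSupport (hasCompactSupport_gradient hψc)
    have h1 := h (m1.toLp, m2.toLp) ⟨ψ, hψ, hψc, hψs, m1.coeFn_toLp, m2.coeFn_toLp⟩
    rw [L2.inner_def] at h1
    rw [← setIntegral_eq_integral_of_forall_compl_eq_zero (s := Ω)]
    · rw [← h1]
      refine integral_congr_ae ?_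
      filter_upwards [m1.coeFn_toLp] with x hx
      simp [hx]
    · intro x hx
      have : ψ x = 0 := by
        by_contra hne
        exact hx (hψs (subset_tsupport _ hne))
      simp [this]

/-- The graph space of `H₀¹(Ω)` inside the Hilbert space `L²(Ω) × L²(Ω; ℝᵈ)`. -/
noncomputable def sobolevSpace (Ω : Set (E d)) : Submodule ℝ (WithLp 2 (L2 Ω × L2Vec Ω)) :=
  (testSubmodule Ω).topologicalClosure.comap
    (WithLp.prodContinuousLinearEquiv 2 ℝ (L2 Ω) (L2Vec Ω)).toLinearMap

lemma mem_sobolevSpace {v : WithLp 2 (L2 Ω × L2Vec Ω)} :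
    v ∈ sobolevSpace Ω ↔ (v.fst, v.snd) ∈ sobolevGraph Ω := Iff.rfl

instance : CompleteSpace (sobolevSpace Ω) := by
  refine IsClosed.completeSpace_coe (hs := ?_)
  exact isClosed_closure.preimage (WithLp.prodContinuousLinearEquiv 2 ℝ (L2 Ω) (L2Vec Ω)).continuous

/-- The Lax–Milgram theorem gives the inverse of the Dirichlet Laplacian; it is symmetric, and
compact because the embedding of `H₀¹(Ω)` into `L²(Ω)` is. -/
lemma exists_solutionOperator (hd : 0 < d) (hΩb : Bornology.IsBounded Ω) :
    ∃ S : L2 Ω →L[ℝ] L2 Ω, IsCompactOperator S ∧ S.IsSymmetric ∧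
      ∀ f, DirichletLaplaceEq Ω (S f) f := by
  obtain ⟨C, hC, hpoin⟩ := exists_poincare hd hΩb
  set π : sobolevSpace Ω →L[ℝ] L2 Ω := WithLp.fstL 2 ℝ _ _ ∘L (sobolevSpace Ω).subtypeL
  set D : sobolevSpace Ω →L[ℝ] L2Vec Ω := WithLp.sndL 2 ℝ _ _ ∘L (sobolevSpace Ω).subtypeL
  have hmem : ∀ v, (π v, D v) ∈ sobolevGraph Ω := fun v => v.2
  -- the Dirichlet form `∫ ∇u · ∇v`, coercive by Poincaré's inequality
  set B : sobolevSpace Ω →L[ℝ] sobolevSpace Ω →L[ℝ] ℝ := (innerSL ℝ).bilinearComp D D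
  have hB : ∀ v w, B v w = inner ℝ (D v) (D w) := fun v w => rfl
  have hcoer : IsCoercive B := by
    refine ⟨(C + 1)⁻¹, by positivity, fun v => ?_⟩
    have h1 : ‖v‖ ^ 2 = ‖π v‖ ^ 2 + ‖D v‖ ^ 2 :=
      WithLp.prod_norm_sq_eq_of_L2 v.1
    have h2 := hpoin _ (hmem v)
    rw [hB, real_inner_self_eq_norm_sq, mul_assoc, inv_mul_le_iff₀ (by positivity), ← sq, h1]
    simp only at h2
    linarith
  set R : L2 Ω →L[ℝ] sobolevSpace Ω :=
    (hcoer.continuousLinearEquivOfBilin.symm : sobolevSpace Ω →L[ℝ] sobolevSpace Ω) ∘L π.adjoint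
  -- `R f` is the weak solution as an element of the graph space
  have hR : ∀ f v, inner ℝ (D (R f)) (D v) = inner ℝ f (π v) := fun f v => by
    rw [← hB, ← hcoer.continuousLinearEquivOfBilin_apply, ← ContinuousLinearMap.adjoint_inner_left]
    congr 1
    exact hcoer.continuousLinearEquivOfBilin.apply_symm_apply _
  refine ⟨π ∘L R, ?_, fun f g => ?_, fun f => ⟨D (R f), hmem _, fun w hw => ?_⟩⟩
  · refine isCompactOperator_of_small_on_finite_codim (κ := Fin d → ℤ) _ fun ε hε => ?_
    set M := ‖D ∘L R‖ + 1
    have hM : 0 < M := by positivity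
    obtain ⟨F, a, ha⟩ := exists_finite_averages (Ω := Ω) hΩb (ε := (ε / M) ^ 2) (by positivity)
    refine ⟨F, a, fun f hf => ?_⟩
    have h1 := ha _ (hmem (R f))
    rw [Finset.sum_eq_zero fun k hk => by
      have := hf k hk
      simp only [ContinuousLinearMap.comp_apply] at this
      simp [this], zero_add, ← mul_pow] at h1
    have h2 : ‖D (R f)‖ ≤ M * ‖f‖ :=
      ((D ∘L R).le_opNorm f).trans (by gcongr; simp [M])
    have h3 := abs_le_of_sq_le_sq h1 (by positivity)
    rw [abs_of_nonneg (norm_nonneg _)] at h3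
    refine h3.trans ?_
    calc ε / M * ‖D (R f)‖ ≤ ε / M * (M * ‖f‖) := by gcongr
      _ = ε * ‖f‖ := by field_simp
  · change inner ℝ (π (R f)) g = inner ℝ f (π (R g))
    rw [← hR, real_inner_comm, ← hR, real_inner_comm]
  · have hw' : WithLp.toLp 2 w ∈ sobolevSpace Ω := mem_sobolevSpace.2 (subset_closure hw)
    exact hR f ⟨_, hw'⟩

/-- The spectral theorem for the solution operator. -/
lemma nonempty_eigensystem (hd : 0 < d) (hΩo : IsOpen Ω) (hΩb : Bornology.IsBounded Ω)
    (hΩne : Ω.Nonempty) : Nonempty (Eigensystem Ω) := by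
  obtain ⟨S, hS, hS', hsol⟩ := exists_solutionOperator hd hΩb
  have : Nontrivial (E d) := by
    have : Nonempty (Fin d) := ⟨⟨0, hd⟩⟩
    infer_instance
  have hinf : Ω.Infinite := by
    obtain ⟨x, hx⟩ := hΩne
    exact infinite_of_mem_nhds x (hΩo.mem_nhds hx)
  have : Fact ((2 : ENNReal) ≠ ⊤) := ⟨by norm_num⟩
  obtain ⟨φ, μ, h⟩ := exists_hilbertBasis_eigenvectors
    (not_finiteDimensional_Lp hΩo hinf hΩb.measure_lt_top.ne) hS hS'
  exact ⟨⟨φ, μ, fun n => h n ▸ hsol (φ n)⟩⟩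

/-- The energy of `μₙ φₙ` is `μₙ`. -/
lemma Eigensystem.exists_gradient (e : Eigensystem Ω) (n : ℕ) :
    ∃ p : L2Vec Ω, (e.μ n • e.φ n, p) ∈ sobolevGraph Ω ∧ ‖p‖ ^ 2 = e.μ n ∧
      ∀ w ∈ testGraph Ω, inner ℝ p w.2 = inner ℝ (e.φ n) w.1 := by
  obtain ⟨p, hp, hw⟩ := e.eigen n
  refine ⟨p, hp, ?_, hw⟩
  have h := inner_eq_of_mem_sobolevGraph hw _ hp
  rw [real_inner_self_eq_norm_sq, real_inner_smul_right, real_inner_self_eq_norm_sq,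
    e.φ.orthonormal.1 n] at h
  simpa using h

/-- If `μₙ = 0`, then the gradient of `μₙ φₙ` vanishes, so `φₙ` is orthogonal to the test
functions. -/
lemma Eigensystem.μ_pos (hΩo : IsOpen Ω) (hΩb : Bornology.IsBounded Ω) (e : Eigensystem Ω)
    (n : ℕ) : 0 < e.μ n := by
  obtain ⟨p, -, h1, h2⟩ := e.exists_gradient n
  refine lt_of_le_of_ne (h1 ▸ sq_nonneg _) fun h0 => ?_
  rw [← h0, sq_eq_zero_iff, norm_eq_zero] at h1
  have h3 := eq_zero_of_forall_testGraph hΩo hΩb (f := e.φ n) fun w hw => by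
    rw [← h2 w hw, h1, inner_zero_left]
  have h4 := e.φ.orthonormal.1 n
  rw [h3, norm_zero] at h4
  exact zero_ne_one h4

lemma tendsto_inner_hilbertBasis {H : Type*} [NormedAddCommGroup H] [InnerProductSpace ℝ H]
    (φ : HilbertBasis ℕ ℝ H) (a : H) :
    Tendsto (fun n => inner ℝ a (φ n)) atTop (𝓝 0) := by
  have h := (φ.orthonormal.inner_products_summable (x := a)).tendsto_atTop_zero
  have h2 := h.sqrt
  simp only [Real.sqrt_zero, Real.sqrt_sq (norm_nonneg _)] at h2
  simpa only [real_inner_comm] using! tendsto_zero_iff_norm_tendsto_zero.2 h2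

/-- The averages of the orthonormal `φₙ` tend to `0`, so the inequality `exists_finite_averages`
for `μₙ φₙ` reads `μₙ² ≤ o(1) μₙ² + ε μₙ`. -/
lemma Eigensystem.tendsto_μ (hΩo : IsOpen Ω) (hΩb : Bornology.IsBounded Ω)
    (e : Eigensystem Ω) : Tendsto e.μ atTop (𝓝 0) := by
  rw [Metric.tendsto_nhds]
  intro ε hε
  obtain ⟨F, a, ha⟩ := exists_finite_averages (Ω := Ω) hΩb (half_pos hε)
  have h0 : Tendsto (fun n => ∑ k ∈ F, inner ℝ (a k) (e.φ n) ^ 2) atTop (𝓝 0) := by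
    simpa using tendsto_finsetSum F fun k _ => (tendsto_inner_hilbertBasis e.φ (a k)).pow 2
  filter_upwards [h0.eventually_lt_const (by norm_num : (0 : ℝ) < 1 / 2)] with n hn
  have hμ := e.μ_pos hΩo hΩb n
  obtain ⟨p, hp, hpn, -⟩ := e.exists_gradient n
  have h1 := ha _ hp
  simp only [norm_smul, e.φ.orthonormal.1 n, mul_one, Real.norm_eq_abs, sq_abs, hpn,
    real_inner_smul_right, mul_pow, ← Finset.mul_sum] at h1
  rw [dist_zero_right, Real.norm_eq_abs, abs_of_pos hμ]
  have h2 : e.μ n ^ 2 < e.μ n * ε := by nlinarith [sq_pos_of_pos hμ]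
  nlinarith

end BackwardHeat

namespace BackwardHeat

/-! ### Block-diagonal operators on a Hilbert sum -/

variable {H X : Type*} [NormedAddCommGroup H] [InnerProductSpace ℝ H] [CompleteSpace H]
  [NormedAddCommGroup X] [InnerProductSpace ℝ X] [CompleteSpace X]

/-- The `n`-th coordinate of a vector with respect to the family of isometries `V`. -/
noncomputable def coord (V : ℕ → H →ₗᵢ[ℝ] X) (n : ℕ) : X →L[ℝ] H :=
  (V n).toContinuousLinearMap.adjoint

variable {V : ℕ → H →ₗᵢ[ℝ] X}

lemma inner_coord (n : ℕ) (h : H) (x : X) : inner ℝ h (coord V n x) = inner ℝ (V n h) x :=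
  ContinuousLinearMap.adjoint_inner_right _ _ _

lemma coord_eq_repr (hV : IsHilbertSum ℝ (fun _ : ℕ => H) V) (n : ℕ) (x : X) :
    coord V n x = hV.linearIsometryEquiv x n := by
  refine ext_inner_left ℝ fun h => ?_
  have h1 := lp.inner_single_left (𝕜 := ℝ) (G := fun _ : ℕ => H) n h (hV.linearIsometryEquiv x)
  rw [inner_coord, ← hV.linearIsometryEquiv_symm_apply_single]
  refine Eq.trans ?_ h1
  rw [← hV.linearIsometryEquiv.inner_map_map, LinearIsometryEquiv.apply_symm_apply]

lemma hasSum_coord (hV : IsHilbertSum ℝ (fun _ : ℕ => H) V) (x : X) :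
    HasSum (fun n => V n (coord V n x)) x := by
  have h := hV.hasSum_linearIsometryEquiv_symm (hV.linearIsometryEquiv x)
  rw [LinearIsometryEquiv.symm_apply_apply] at h
  simpa only [coord_eq_repr hV] using h

lemma ext_coord (hV : IsHilbertSum ℝ (fun _ : ℕ => H) V) {x y : X}
    (h : ∀ n, coord V n x = coord V n y) : x = y := by
  have h1 := hasSum_coord hV x
  simp only [h] at h1
  exact h1.unique (hasSum_coord hV y)

lemma hasSum_norm_sq_coord (hV : IsHilbertSum ℝ (fun _ : ℕ => H) V) (x : X) :
    HasSum (fun n => ‖coord V n x‖ ^ 2) (‖x‖ ^ 2) := by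
  have h := lp.hasSum_norm (p := 2) (by norm_num) (hV.linearIsometryEquiv x)
  simpa [coord_eq_repr hV] using h

lemma coord_self (n : ℕ) (h : H) : coord V n (V n h) = h :=
  ext_inner_left ℝ fun k => by rw [inner_coord, LinearIsometry.inner_map_map]

lemma coord_of_ne (hV : IsHilbertSum ℝ (fun _ : ℕ => H) V) {m n : ℕ} (hmn : m ≠ n) (h : H) :
    coord V m (V n h) = 0 :=
  ext_inner_left ℝ fun k => by
    rw [inner_coord, inner_zero_right]; exact hV.OrthogonalFamily hmn k h

/-- The operator `G` acts on the `n`-th summand of a Hilbert sum as `A n`. -/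
def IsBlockDiagonal (V : ℕ → H →ₗᵢ[ℝ] X) (A : ℕ → H →L[ℝ] H) (G : X →L[ℝ] X) : Prop :=
  ∀ n x, coord V n (G x) = A n (coord V n x)

variable {A B : ℕ → H →L[ℝ] H} {G G' : X →L[ℝ] X}

lemma IsBlockDiagonal.norm_le (hV : IsHilbertSum ℝ (fun _ : ℕ => H) V)
    (hG : IsBlockDiagonal V A G) {K : ℝ} (hK : 0 ≤ K) (hA : ∀ n, ‖A n‖ ≤ K) : ‖G‖ ≤ K := by
  refine ContinuousLinearMap.opNorm_le_bound _ hK fun x => ?_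
  refine abs_le_of_sq_le_sq' ?_ (by positivity) |>.2
  rw [mul_pow]
  refine hasSum_le (fun n => ?_) (hasSum_norm_sq_coord hV (G x))
    ((hasSum_norm_sq_coord hV x).mul_left (K ^ 2))
  rw [hG, ← mul_pow]
  gcongr
  exact (A n).le_of_opNorm_le (hA n) _

/-- Uniformly bounded blocks define a bounded operator. -/
lemma exists_isBlockDiagonal (hV : IsHilbertSum ℝ (fun _ : ℕ => H) V) {K : ℝ}
    (hA : ∀ n, ‖A n‖ ≤ K) : ∃ G : X →L[ℝ] X, IsBlockDiagonal V A G := by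
  have hK : 0 ≤ K := (norm_nonneg _).trans (hA 0)
  have hle : ∀ x n, ‖A n (coord V n x)‖ ^ 2 ≤ K ^ 2 * ‖coord V n x‖ ^ 2 := fun x n => by
    rw [← mul_pow]; gcongr; exact (A n).le_of_opNorm_le (hA n) _
  have hs : ∀ x, Summable fun n => V n (A n (coord V n x)) := fun x =>
    hV.OrthogonalFamily.summable_iff_norm_sq_summable _ |>.2
      (((hasSum_norm_sq_coord hV x).summable.mul_left (K ^ 2)).of_nonneg_of_le
        (fun _ => sq_nonneg _) (hle x))
  have hc : ∀ x n, coord V n (∑' m, V m (A m (coord V m x))) = A n (coord V n x) := fun x n => by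
    rw [(coord V n).map_tsum (hs x), tsum_eq_single n fun m hm => coord_of_ne hV hm.symm _,
      coord_self]
  let L : X →ₗ[ℝ] X :=
    { toFun := fun x => ∑' m, V m (A m (coord V m x))
      map_add' := fun x y => by simp only [map_add]; exact (hs x).tsum_add (hs y)
      map_smul' := fun c x => by simp only [map_smul]; exact (hs x).tsum_const_smul c }
  refine ⟨L.mkContinuous K fun x => ?_, fun n x => hc x n⟩
  refine abs_le_of_sq_le_sq' ?_ (by positivity) |>.2
  rw [mul_pow]
  refine hasSum_le (fun n => ?_) (hasSum_norm_sq_coord hV (L x))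
    ((hasSum_norm_sq_coord hV x).mul_left (K ^ 2))
  exact (congrArg (‖·‖ ^ 2) (hc x n)).le.trans (hle x n)

lemma IsBlockDiagonal.apply_V (hV : IsHilbertSum ℝ (fun _ : ℕ => H) V)
    (hG : IsBlockDiagonal V A G) (n : ℕ) (h : H) : G (V n h) = V n (A n h) := by
  refine ext_coord hV fun m => ?_
  rw [hG]
  rcases eq_or_ne m n with rfl | hmn
  · rw [coord_self, coord_self]
  · rw [coord_of_ne hV hmn, coord_of_ne hV hmn, map_zero]

lemma IsBlockDiagonal.isSelfAdjoint (hV : IsHilbertSum ℝ (fun _ : ℕ => H) V)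
    (hG : IsBlockDiagonal V A G) (hA : ∀ n x y, inner ℝ (A n x) y = inner ℝ x (A n y)) :
    IsSelfAdjoint G := by
  rw [ContinuousLinearMap.isSelfAdjoint_iff']
  refine ContinuousLinearMap.ext fun y => ext_coord hV fun n => ext_inner_left ℝ fun h => ?_
  rw [inner_coord, ContinuousLinearMap.adjoint_inner_right, hG.apply_V hV, ← inner_coord, hA, hG]

lemma IsBlockDiagonal.sub (hG : IsBlockDiagonal V A G) (hG' : IsBlockDiagonal V B G') :
    IsBlockDiagonal V (fun n => A n - B n) (G - G') := fun n x => by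
  simp [hG n x, hG' n x]

/-- A block-diagonal operator with compact blocks whose norms tend to `0` is the norm limit of its
finite truncations, hence compact. -/
lemma IsBlockDiagonal.isCompactOperator (hV : IsHilbertSum ℝ (fun _ : ℕ => H) V)
    (hG : IsBlockDiagonal V A G) (hA : ∀ n, IsCompactOperator (A n))
    (hlim : Tendsto (fun n => ‖A n‖) atTop (𝓝 0)) : IsCompactOperator G := by
  set P : ℕ → X →L[ℝ] X := fun N =>
    ∑ n ∈ Finset.range N, (V n).toContinuousLinearMap ∘L A n ∘L coord V n
  have hPc : ∀ N, IsCompactOperator (P N) := fun N => by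
    refine Submodule.sum_mem (compactOperator (RingHom.id ℝ) X X) fun n _ => ?_
    exact ((hA n).comp_clm (coord V n)).clm_comp (V n).toContinuousLinearMap
  have hP : ∀ N, IsBlockDiagonal V (fun n => if n < N then A n else 0) (P N) := fun N n x => by
    simp only [P, sum_apply, map_sum, ContinuousLinearMap.comp_apply,
      LinearIsometry.coe_toContinuousLinearMap]
    by_cases hn : n < N
    · rw [if_pos hn, Finset.sum_eq_single_of_mem n (Finset.mem_range.2 hn)
        fun m _ hm => coord_of_ne hV hm.symm _, coord_self]
    · rw [if_neg hn, Finset.sum_eq_zero fun m hm => coord_of_ne hV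
        (by rintro rfl; exact hn (Finset.mem_range.1 hm)) _, zero_apply]
  refine isCompactOperator_of_tendsto (l := atTop) (F := P) ?_ (Eventually.of_forall hPc)
  rw [Metric.tendsto_atTop]
  intro ε hε
  obtain ⟨N, hN⟩ := eventually_atTop.1 (hlim.eventually_le_const (half_pos hε))
  refine ⟨N, fun M hM => lt_of_le_of_lt ?_ (half_lt_self hε)⟩
  rw [dist_comm, dist_eq_norm]
  refine (hG.sub (hP M)).norm_le hV (half_pos hε).le fun n => ?_
  by_cases hn : n < M
  · simpa [hn] using (half_pos hε).le
  · simpa [hn] using hN n (by omega)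

/-- Uniformly bounded inverses of the blocks assemble to an inverse. -/
lemma IsBlockDiagonal.notMem_spectrum (hV : IsHilbertSum ℝ (fun _ : ℕ => H) V)
    (hG : IsBlockDiagonal V A G) {l : ℝ} {R : ℕ → H →L[ℝ] H} {K : ℝ} (hR : ∀ n, ‖R n‖ ≤ K)
    (h1 : ∀ n, (algebraMap ℝ (H →L[ℝ] H) l - A n) * R n = 1)
    (h2 : ∀ n, R n * (algebraMap ℝ (H →L[ℝ] H) l - A n) = 1) : l ∉ spectrum ℝ G := by
  obtain ⟨S, hS⟩ := exists_isBlockDiagonal hV hR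
  have hl : ∀ n x, coord V n ((algebraMap ℝ (X →L[ℝ] X) l - G) x) =
      (algebraMap ℝ (H →L[ℝ] H) l - A n) (coord V n x) := fun n x => by
    simp [Algebra.algebraMap_eq_smul_one, hG n x]
  rw [spectrum.notMem_iff]
  refine ⟨⟨algebraMap ℝ (X →L[ℝ] X) l - G, S, ?_, ?_⟩, rfl⟩
  · refine ContinuousLinearMap.ext fun x => ext_coord hV fun n => ?_
    rw [mul_apply_eq_comp, hl, hS, ← mul_apply_eq_comp, h1]; rfl
  · refine ContinuousLinearMap.ext fun x => ext_coord hV fun n => ?_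
    rw [mul_apply_eq_comp, hS, hl, ← mul_apply_eq_comp, h2]; rfl

end BackwardHeat

namespace BackwardHeat

/-! ### The operator on a single mode -/

lemma withLp_prod_ext {Y Y' : Type*} {h h' : WithLp 2 (Y × Y')} (h1 : h.fst = h'.fst)
    (h2 : h.snd = h'.snd) : h = h' :=
  (WithLp.equiv 2 (Y × Y')).injective (Prod.ext h1 h2)

lemma norm_fst_le {Y : Type*} [NormedAddCommGroup Y] (h : WithLp 2 (Y × ℝ)) :
    ‖h.fst‖ ≤ ‖h‖ := by
  refine abs_le_of_sq_le_sq' ?_ (norm_nonneg _) |>.2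
  rw [WithLp.prod_norm_sq_eq_of_L2]; nlinarith [sq_nonneg ‖h.snd‖]

lemma norm_snd_le {Y : Type*} [NormedAddCommGroup Y] (h : WithLp 2 (Y × ℝ)) :
    ‖h.snd‖ ≤ ‖h‖ := by
  refine abs_le_of_sq_le_sq' ?_ (norm_nonneg _) |>.2
  rw [WithLp.prod_norm_sq_eq_of_L2]; nlinarith [sq_nonneg ‖h.fst‖]

lemma norm_le_fst_add_snd {Y : Type*} [NormedAddCommGroup Y] (h : WithLp 2 (Y × ℝ)) :
    ‖h‖ ≤ ‖h.fst‖ + ‖h.snd‖ := by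
  refine abs_le_of_sq_le_sq' ?_ (by positivity) |>.2
  rw [WithLp.prod_norm_sq_eq_of_L2]
  nlinarith [mul_nonneg (norm_nonneg h.fst) (norm_nonneg h.snd)]

variable {Y : Type*} [NormedAddCommGroup Y] [InnerProductSpace ℝ Y]

/-- The action of `G` on one mode: with `b` the constant function `1`, `e` the decaying exponential,
`γ = 1 / μ` and `s = T + μ`, it maps `(f, g)` to
`(f + γ ⟨e, f⟩ e + g (b + e), ⟨b, f⟩ + ⟨e, f⟩ + s g)`. -/
noncomputable def modeOp (b e : Y) (γ s : ℝ) : WithLp 2 (Y × ℝ) →L[ℝ] WithLp 2 (Y × ℝ) :=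
  (WithLp.prodContinuousLinearEquiv 2 ℝ Y ℝ).symm.toContinuousLinearMap ∘L
    ((WithLp.fstL 2 ℝ Y ℝ + (γ • (innerSL ℝ e ∘L WithLp.fstL 2 ℝ Y ℝ)).smulRight e +
      (WithLp.sndL 2 ℝ Y ℝ).smulRight (b + e)).prod
    ((innerSL ℝ b + innerSL ℝ e) ∘L WithLp.fstL 2 ℝ Y ℝ + s • WithLp.sndL 2 ℝ Y ℝ))

/-- The action of `G₀` on one mode: `(f, g) ↦ (f + γ ⟨e, f⟩ e + g b, ⟨b, f⟩ + s g)`. -/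
noncomputable def modeOp₀ (b e : Y) (γ s : ℝ) : WithLp 2 (Y × ℝ) →L[ℝ] WithLp 2 (Y × ℝ) :=
  (WithLp.prodContinuousLinearEquiv 2 ℝ Y ℝ).symm.toContinuousLinearMap ∘L
    ((WithLp.fstL 2 ℝ Y ℝ + (γ • (innerSL ℝ e ∘L WithLp.fstL 2 ℝ Y ℝ)).smulRight e +
      (WithLp.sndL 2 ℝ Y ℝ).smulRight b).prod
    (innerSL ℝ b ∘L WithLp.fstL 2 ℝ Y ℝ + s • WithLp.sndL 2 ℝ Y ℝ))

section

variable (b e : Y) (γ s s' : ℝ) (h h' : WithLp 2 (Y × ℝ))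

lemma modeOp_fst : (modeOp b e γ s h).fst =
    h.fst + (γ * inner ℝ e h.fst) • e + h.snd • (b + e) := rfl

lemma modeOp_snd : (modeOp b e γ s h).snd = inner ℝ b h.fst + inner ℝ e h.fst + s * h.snd := rfl

lemma modeOp₀_fst : (modeOp₀ b e γ s h).fst =
    h.fst + (γ * inner ℝ e h.fst) • e + h.snd • b := rfl

lemma modeOp₀_snd : (modeOp₀ b e γ s h).snd = inner ℝ b h.fst + s * h.snd := rfl

lemma modeOp_symmetric : inner ℝ (modeOp b e γ s h) h' = inner ℝ h (modeOp b e γ s h') := by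
  simp only [WithLp.prod_inner_apply]
  change inner ℝ (modeOp b e γ s h).fst h'.fst + inner ℝ (modeOp b e γ s h).snd h'.snd =
    inner ℝ h.fst (modeOp b e γ s h').fst + inner ℝ h.snd (modeOp b e γ s h').snd
  rw [modeOp_fst, modeOp_fst, modeOp_snd, modeOp_snd]
  simp only [inner_add_left, inner_add_right, real_inner_smul_left, real_inner_smul_right,
    real_inner_comm h.fst, RCLike.inner_apply, conj_trivial]
  ring

lemma norm_modeOp_le (hγ : 0 ≤ γ) :
    ‖modeOp b e γ s‖ ≤ 1 + γ * ‖e‖ ^ 2 + 2 * (‖b‖ + ‖e‖) + |s| := by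
  refine ContinuousLinearMap.opNorm_le_bound _ (by positivity) fun h => ?_
  refine (norm_le_fst_add_snd _).trans ?_
  have h1 := norm_fst_le h
  have h2 := norm_snd_le h
  have a1 : ‖(modeOp b e γ s h).fst‖ ≤ ‖h‖ + γ * ‖e‖ ^ 2 * ‖h‖ + ‖h‖ * (‖b‖ + ‖e‖) := by
    rw [modeOp_fst]
    refine (norm_add_le _ _).trans (add_le_add ((norm_add_le _ _).trans (add_le_add h1 ?_)) ?_)
    · rw [norm_smul, norm_mul, Real.norm_of_nonneg hγ]
      calc γ * ‖inner ℝ e h.fst‖ * ‖e‖ ≤ γ * (‖e‖ * ‖h‖) * ‖e‖ := by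
            gcongr; exact (norm_inner_le_norm _ _).trans (by gcongr)
        _ = γ * ‖e‖ ^ 2 * ‖h‖ := by ring
    · rw [norm_smul]; gcongr; exact norm_add_le _ _
  have a2 : ‖(modeOp b e γ s h).snd‖ ≤ ‖b‖ * ‖h‖ + ‖e‖ * ‖h‖ + |s| * ‖h‖ := by
    rw [modeOp_snd]
    refine (norm_add_le _ _).trans (add_le_add ((norm_add_le _ _).trans (add_le_add ?_ ?_)) ?_)
    · exact (norm_inner_le_norm _ _).trans (by gcongr)
    · exact (norm_inner_le_norm _ _).trans (by gcongr)
    · rw [norm_mul, Real.norm_eq_abs s]; gcongr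
  linarith

lemma norm_modeOp_sub_le : ‖modeOp b e γ s - modeOp₀ b e γ s'‖ ≤ 2 * ‖e‖ + |s - s'| := by
  refine ContinuousLinearMap.opNorm_le_bound _ (by positivity) fun h => ?_
  refine (norm_le_fst_add_snd _).trans ?_
  have h1 := norm_fst_le h
  have h2 := norm_snd_le h
  have e1 : ((modeOp b e γ s - modeOp₀ b e γ s') h).fst = h.snd • e := by
    change (modeOp b e γ s h).fst - (modeOp₀ b e γ s' h).fst = _
    rw [modeOp_fst, modeOp₀_fst]; module
  have e2 : ((modeOp b e γ s - modeOp₀ b e γ s') h).snd =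
      inner ℝ e h.fst + (s - s') * h.snd := by
    change (modeOp b e γ s h).snd - (modeOp₀ b e γ s' h).snd = _
    rw [modeOp_snd, modeOp₀_snd]; ring
  have a1 : ‖h.snd • e‖ ≤ ‖e‖ * ‖h‖ := by rw [norm_smul, mul_comm]; gcongr
  have a2 : ‖inner ℝ e h.fst + (s - s') * h.snd‖ ≤ ‖e‖ * ‖h‖ + |s - s'| * ‖h‖ := by
    refine (norm_add_le _ _).trans (add_le_add ?_ ?_)
    · exact (norm_inner_le_norm _ _).trans (by gcongr)
    · rw [norm_mul, Real.norm_eq_abs (s - s')]; gcongr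
  rw [e1, e2]
  linarith

/-- The difference `(f, g) ↦ (g e, ⟨e, f⟩ + (s - s') g)` has rank at most two. -/
lemma isCompactOperator_modeOp_sub : IsCompactOperator (modeOp b e γ s - modeOp₀ b e γ s') := by
  set L : ℝ × ℝ →L[ℝ] WithLp 2 (Y × ℝ) :=
    (WithLp.prodContinuousLinearEquiv 2 ℝ Y ℝ).symm.toContinuousLinearMap ∘L
      ((ContinuousLinearMap.toSpanSingleton ℝ e).prodMap (ContinuousLinearMap.id ℝ ℝ))
  set M : WithLp 2 (Y × ℝ) →L[ℝ] ℝ × ℝ := (WithLp.sndL 2 ℝ Y ℝ).prod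
    (innerSL ℝ e ∘L WithLp.fstL 2 ℝ Y ℝ + (s - s') • WithLp.sndL 2 ℝ Y ℝ)
  have hLM : modeOp b e γ s - modeOp₀ b e γ s' = L ∘L M := by
    refine ContinuousLinearMap.ext fun h => withLp_prod_ext ?_ ?_
    · change (modeOp b e γ s h).fst - (modeOp₀ b e γ s' h).fst = h.snd • e
      rw [modeOp_fst, modeOp₀_fst]; module
    · change (modeOp b e γ s h).snd - (modeOp₀ b e γ s' h).snd =
        inner ℝ e h.fst + (s - s') * h.snd
      rw [modeOp_snd, modeOp₀_snd]; ring
  rw [hLM]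
  exact (isCompactOperator_of_locallyCompactSpace_dom M).clm_comp L

/-- The vector `(x b + y e, z)`. -/
def modeVec (x y z : ℝ) : WithLp 2 (Y × ℝ) := WithLp.toLp 2 (x • b + y • e, z)

lemma modeVec_fst (x y z : ℝ) : (modeVec b e x y z).fst = x • b + y • e := rfl

lemma modeVec_snd (x y z : ℝ) : (modeVec b e x y z).snd = z := rfl

lemma modeOp_sub_self :
    modeOp b e γ s h - h = modeVec b e h.snd (h.snd + γ * inner ℝ e h.fst)
      (inner ℝ b h.fst + inner ℝ e h.fst + (s - 1) * h.snd) := by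
  refine withLp_prod_ext ?_ ?_
  · change (modeOp b e γ s h).fst - h.fst = _ • b + _ • e
    rw [modeOp_fst]; module
  · change (modeOp b e γ s h).snd - h.snd = _
    rw [modeOp_snd, modeVec_snd]; ring

end

/-- The vectors `b` and `e` have the inner products that the functions `1` and `e^{-(T-t)/μ}` have in
`L²(0, T)`. -/
structure IsModePair (T μ : ℝ) (b e : Y) : Prop where
  inner_bb : inner ℝ b b = T
  inner_be : inner ℝ b e = μ * (1 - Real.exp (-(T / μ)))
  inner_ee : inner ℝ e e = μ * (1 - Real.exp (-(T / μ)) ^ 2) / 2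

variable {T μ : ℝ} {b e : Y}

/-- The vectors `b` and `e` are independent: their Gram determinant is `μ` times the value of the cubic at `1`. -/
lemma IsModePair.modeVec_eq_zero (hbe : IsModePair T μ b e) (hT : 0 < T) (hμ : 0 < μ)
    {x y z : ℝ} (h : modeVec b e x y z = 0) : x = 0 ∧ y = 0 ∧ z = 0 := by
  have h1 : x • b + y • e = 0 := congrArg WithLp.fst h
  have h2 : z = 0 := congrArg WithLp.snd h
  have hb : x * T + y * (μ * (1 - Real.exp (-(T / μ)))) = 0 := by
    have := congrArg (inner ℝ b) h1
    rwa [inner_add_right, real_inner_smul_right, real_inner_smul_right, hbe.inner_bb,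
      hbe.inner_be, inner_zero_right] at this
  have he : x * (μ * (1 - Real.exp (-(T / μ)))) +
      y * (μ * (1 - Real.exp (-(T / μ)) ^ 2) / 2) = 0 := by
    have := congrArg (inner ℝ e) h1
    rwa [inner_add_right, real_inner_smul_right, real_inner_smul_right, hbe.inner_ee,
      real_inner_comm, hbe.inner_be, inner_zero_right] at this
  have hdet : 0 < μ * cubic T μ 1 := mul_pos hμ (cubic_one_pos hT hμ)
  rw [cubic_one] at hdet
  refine ⟨?_, ?_, h2⟩
  · refine (mul_eq_zero_iff_right hdet.ne').1 ?_
    linear_combination (μ * (1 - Real.exp (-(T / μ)) ^ 2) / 2) * hb -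
      (μ * (1 - Real.exp (-(T / μ)))) * he
  · refine (mul_eq_zero_iff_right hdet.ne').1 ?_
    linear_combination T * he - (μ * (1 - Real.exp (-(T / μ)))) * hb

lemma IsModePair.modeOp_modeVec (hbe : IsModePair T μ b e) (hμ : μ ≠ 0) (x y z : ℝ) :
    modeOp b e μ⁻¹ (T + μ) (modeVec b e x y z) =
      modeVec b e (x + z)
        ((1 - Real.exp (-(T / μ))) * x + (1 + (1 - Real.exp (-(T / μ)) ^ 2) / 2) * y + z)
        ((T + μ * (1 - Real.exp (-(T / μ)))) * x +
          (μ * (1 - Real.exp (-(T / μ))) + μ * (1 - Real.exp (-(T / μ)) ^ 2) / 2) * y +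
          (T + μ) * z) := by
  have hb : inner ℝ b (x • b + y • e) = x * T + y * (μ * (1 - Real.exp (-(T / μ)))) := by
    rw [inner_add_right, real_inner_smul_right, real_inner_smul_right, hbe.inner_bb,
      hbe.inner_be]
  have he : inner ℝ e (x • b + y • e) = x * (μ * (1 - Real.exp (-(T / μ)))) +
      y * (μ * (1 - Real.exp (-(T / μ)) ^ 2) / 2) := by
    rw [inner_add_right, real_inner_smul_right, real_inner_smul_right, hbe.inner_ee,
      real_inner_comm, hbe.inner_be]
  refine withLp_prod_ext ?_ ?_
  · rw [modeOp_fst]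
    change x • b + y • e + (μ⁻¹ * inner ℝ e (x • b + y • e)) • e + z • (b + e) = _ • b + _ • e
    have hγ : μ⁻¹ * inner ℝ e (x • b + y • e) = (1 - Real.exp (-(T / μ))) * x +
        (1 - Real.exp (-(T / μ)) ^ 2) / 2 * y := by
      rw [he]; field_simp
    rw [hγ]
    module
  · rw [modeOp_snd]
    change inner ℝ b (x • b + y • e) + inner ℝ e (x • b + y • e) + (T + μ) * z = _
    rw [hb, he, modeVec_snd]
    ring

/-- `x b + y e + z` is an eigenvector for every root of the cubic, with explicit coefficients. -/
lemma IsModePair.exists_eigenvector (hbe : IsModePair T μ b e) (hT : 0 < T) (hμ : 0 < μ) {l : ℝ}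
    (hl : cubic T μ l = 0) : ∃ h ≠ 0, modeOp b e μ⁻¹ (T + μ) h = l • h := by
  have hq1 := exp_neg_div_lt_one hT hμ
  have hq := Real.exp_pos (-(T / μ))
  set q := Real.exp (-(T / μ)) with hqdef
  refine ⟨modeVec b e (l - (1 + (1 - q ^ 2) / 2)) (l - q) ((l - 1) * (l - (1 + (1 - q ^ 2) / 2))),
    fun h0 => ?_, ?_⟩
  · obtain ⟨h1, h2, -⟩ := hbe.modeVec_eq_zero hT hμ h0
    -- the coefficients of `b` and `e` do not vanish together: `1 + (1 - q²) / 2 > 1 > q`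
    nlinarith
  · rw [hbe.modeOp_modeVec hμ.ne', ← hqdef]
    rw [cubic, alpha, beta, exp_neg_two_mul_div, ← hqdef] at hl
    refine withLp_prod_ext ?_ ?_
    · rw [WithLp.smul_fst, modeVec_fst, modeVec_fst]
      module
    · rw [WithLp.smul_snd, modeVec_snd, modeVec_snd, smul_eq_mul]
      linear_combination -hl

/-- Cayley–Hamilton on the span of `(b, 0)`, `(e, 0)`, `(0, 1)`, which contains the range of
`modeOp - 1`. -/
lemma IsModePair.cubic_modeOp_eq_zero (hbe : IsModePair T μ b e) (hμ : μ ≠ 0)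
    {A : WithLp 2 (Y × ℝ) →L[ℝ] WithLp 2 (Y × ℝ)} (hA : A = modeOp b e μ⁻¹ (T + μ)) :
    (A ^ 3 - (T + 5 / 2 + alpha T μ) • A ^ 2 + (3 / 2 * (T + 1) + beta T μ) • A -
      (μ * Real.exp (-(2 * T / μ))) • 1) * (A - 1) = 0 := by
  refine ContinuousLinearMap.ext fun h => ?_
  have h1 : (A - 1) h = modeOp b e μ⁻¹ (T + μ) h - h := by rw [hA]; rfl
  rw [mul_apply_eq_comp, h1, modeOp_sub_self]
  generalize h.snd = x
  generalize x + μ⁻¹ * inner ℝ e h.fst = y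
  generalize inner ℝ b h.fst + inner ℝ e h.fst + (T + μ - 1) * x = z
  have h2 : ∀ v, (A ^ 3 - (T + 5 / 2 + alpha T μ) • A ^ 2 + (3 / 2 * (T + 1) + beta T μ) • A -
      (μ * Real.exp (-(2 * T / μ))) • (1 : WithLp 2 (Y × ℝ) →L[ℝ] WithLp 2 (Y × ℝ))) v = A (A (A v)) - (T + 5 / 2 + alpha T μ) • A (A v) +
      (3 / 2 * (T + 1) + beta T μ) • A v - (μ * Real.exp (-(2 * T / μ))) • v := fun v => rfl
  rw [h2, hA]
  simp only [hbe.modeOp_modeVec hμ]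
  rw [alpha, beta, exp_neg_two_mul_div]
  generalize Real.exp (-(T / μ)) = q
  refine withLp_prod_ext ?_ ?_
  · simp only [zero_apply, WithLp.sub_fst, WithLp.add_fst, WithLp.smul_fst, WithLp.zero_fst, modeVec_fst]
    module
  · simp only [zero_apply, WithLp.sub_snd, WithLp.add_snd, WithLp.smul_snd, WithLp.zero_snd, modeVec_snd,
      smul_eq_mul]
    ring

/-- The resolvent at `l` of an operator `A` with `(A³ - u A² + v A - w) (A - 1) = 0`, as a polynomial in
`A`. It is meaningful if `l ≠ 1` and `l³ - u l² + v l - w ≠ 0`. -/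
noncomputable def cubicResolvent {R : Type*} [Ring R] [Algebra ℝ R] (A : R) (u v w l : ℝ) : R :=
  (l - 1)⁻¹ • (1 + (l ^ 3 - l ^ 2 * u + l * v - w)⁻¹ •
    ((A - 1) * (A ^ 2 + (l - u) • A + (l ^ 2 - l * u + v) • 1)))

lemma cubicResolvent_mul {R : Type*} [Ring R] [Algebra ℝ R] {A : R} {u v w l : ℝ}
    (hA : (A ^ 3 - u • A ^ 2 + v • A - w • 1) * (A - 1) = 0)
    (hl : l ^ 3 - l ^ 2 * u + l * v - w ≠ 0) (hl1 : l ≠ 1) :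
    (algebraMap ℝ R l - A) * cubicResolvent A u v w l = 1 ∧
      cubicResolvent A u v w l * (algebraMap ℝ R l - A) = 1 := by
  -- both factors are values at `A` of polynomials
  set c := l ^ 3 - l ^ 2 * u + l * v - w with hc
  set P : Polynomial ℝ := (Polynomial.X ^ 3 - Polynomial.C u * Polynomial.X ^ 2 +
    Polynomial.C v * Polynomial.X - Polynomial.C w) * (Polynomial.X - 1)
  set Q : Polynomial ℝ := Polynomial.C (l - 1)⁻¹ * (1 + Polynomial.C c⁻¹ *
    ((Polynomial.X - 1) * (Polynomial.X ^ 2 + Polynomial.C (l - u) * Polynomial.X +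
      Polynomial.C (l ^ 2 - l * u + v) * 1)))
  have hP : Polynomial.aeval A P = 0 := by
    rw [← hA]
    simp [P, Algebra.smul_def]
  have hQ : Polynomial.aeval A Q = cubicResolvent A u v w l := by
    simp [Q, cubicResolvent, Algebra.smul_def, ← hc]
  have hXQ : (Polynomial.C l - Polynomial.X) * Q =
      1 - Polynomial.C ((l - 1)⁻¹ * c⁻¹) * P := by
    have h1 : Polynomial.C (l - 1)⁻¹ * (Polynomial.C l - 1) = 1 := by
      rw [← Polynomial.C_1, ← Polynomial.C_sub, ← Polynomial.C_mul,
        inv_mul_cancel₀ (sub_ne_zero.2 hl1)]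
    have h2 : Polynomial.C c⁻¹ * (Polynomial.C l ^ 3 - Polynomial.C l ^ 2 * Polynomial.C u +
        Polynomial.C l * Polynomial.C v - Polynomial.C w) = 1 := by
      rw [← Polynomial.C_1, ← inv_mul_cancel₀ hl, Polynomial.C_mul, hc]
      simp
    simp only [Q, P, Polynomial.C_mul, Polynomial.C_sub, Polynomial.C_add, Polynomial.C_pow]
    linear_combination h1 + Polynomial.C (l - 1)⁻¹ * (Polynomial.X - 1) * h2
  have h3 : (algebraMap ℝ R l - A) * cubicResolvent A u v w l = 1 := by
    have := congrArg (Polynomial.aeval A) hXQ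
    rw [map_mul, hQ, map_sub, map_sub, map_mul _ _ P, hP, mul_zero, sub_zero, map_one,
      Polynomial.aeval_C, Polynomial.aeval_X] at this
    exact this
  refine ⟨h3, ?_⟩
  have h4 : Polynomial.aeval A (Polynomial.C l - Polynomial.X) = algebraMap ℝ R l - A := by simp
  rw [← h3, ← hQ, ← h4, ← map_mul, ← map_mul, mul_comm]

end BackwardHeat

namespace BackwardHeat

/-! ### Decomposition of the state space into modes -/

/-- The scalar space `L²(0, T)`. -/
abbrev TimeL2 (T : ℝ) : Type := Lp ℝ 2 (volume.restrict (Set.Ioo 0 T))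

lemma memLp_of_continuous (T : ℝ) {f : ℝ → ℝ} (hf : Continuous f) :
    MemLp f 2 (volume.restrict (Set.Ioo 0 T)) := by
  obtain ⟨C, hC⟩ := (isCompact_Icc (a := (0 : ℝ)) (b := T)).exists_bound_of_continuousOn
    hf.continuousOn
  refine MemLp.of_bound hf.aestronglyMeasurable C ?_
  filter_upwards [ae_restrict_mem measurableSet_Ioo] with t ht
  exact hC t (Set.Ioo_subset_Icc_self ht)

/-- A continuous function as an element of `L²(0, T)`. -/
noncomputable def contTime (T : ℝ) (f : ℝ → ℝ) (hf : Continuous f) : TimeL2 T :=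
  (memLp_of_continuous T hf).toLp

lemma coeFn_contTime (T : ℝ) {f : ℝ → ℝ} (hf : Continuous f) :
    ∀ᵐ t ∂(volume.restrict (Set.Ioo 0 T)), contTime T f hf t = f t :=
  (memLp_of_continuous T hf).coeFn_toLp

lemma inner_contTime (T : ℝ) {f : ℝ → ℝ} (hf : Continuous f) (g : TimeL2 T) :
    inner ℝ (contTime T f hf) g = ∫ t in Set.Ioo 0 T, f t * g t := by
  rw [L2.inner_def]
  refine integral_congr_ae ?_
  filter_upwards [coeFn_contTime T hf] with t ht
  simp [ht, mul_comm]

lemma inner_contTime_contTime (T : ℝ) {f g : ℝ → ℝ} (hf : Continuous f) (hg : Continuous g) :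
    inner ℝ (contTime T f hf) (contTime T g hg) = ∫ t in Set.Ioo 0 T, f t * g t := by
  rw [inner_contTime]
  refine integral_congr_ae ?_
  filter_upwards [coeFn_contTime T hg] with t ht
  rw [ht]

/-- The constant function `1` in `L²(0, T)`. -/
noncomputable def oneTime (T : ℝ) : TimeL2 T := contTime T (fun _ => 1) continuous_const

/-- The function `t ↦ e^{-(T-t)/μ}` in `L²(0, T)`, for `μ ≠ 0`. -/
noncomputable def expTime (T μ : ℝ) : TimeL2 T :=
  contTime T (fun t => Real.exp (-(μ⁻¹ * (T - t)))) (by fun_prop)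

lemma integral_exp_neg_mul_sub {T c : ℝ} (hT : 0 < T) (hc : c ≠ 0) :
    ∫ t in Set.Ioo 0 T, Real.exp (-(c * (T - t))) = c⁻¹ * (1 - Real.exp (-(c * T))) := by
  rw [← integral_Ioc_eq_integral_Ioo, ← intervalIntegral.integral_of_le hT.le,
    intervalIntegral.integral_eq_sub_of_hasDerivAt
      (f := fun t => c⁻¹ * Real.exp (-(c * (T - t))))]
  · simp; ring
  · intro t _
    have h : HasDerivAt (fun t : ℝ => -(c * (T - t))) c t := by
      simpa using! (((hasDerivAt_id t).const_sub T).const_mul c).neg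
    have h2 := h.exp.const_mul c⁻¹
    convert! h2 using 1
    field_simp
  · exact Continuous.intervalIntegrable (by fun_prop) _ _

lemma isModePair_time {T μ : ℝ} (hT : 0 < T) (hμ : 0 < μ) :
    IsModePair T μ (oneTime T) (expTime T μ) where
  inner_bb := by
    rw [oneTime, inner_contTime_contTime]
    simp [hT.le]
  inner_be := by
    rw [oneTime, expTime, inner_contTime_contTime]
    simp only [one_mul]
    rw [integral_exp_neg_mul_sub hT (inv_ne_zero hμ.ne'), inv_inv, inv_mul_eq_div]
  inner_ee := by
    rw [expTime, inner_contTime_contTime]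
    have h : ∀ t, Real.exp (-(μ⁻¹ * (T - t))) * Real.exp (-(μ⁻¹ * (T - t))) =
        Real.exp (-(2 * μ⁻¹ * (T - t))) := fun t => by
      rw [← Real.exp_add]; congr 1; ring
    simp only [h]
    rw [integral_exp_neg_mul_sub hT (mul_ne_zero two_ne_zero (inv_ne_zero hμ.ne')),
      ← exp_neg_two_mul_div, show 2 * μ⁻¹ * T = 2 * T / μ by ring, mul_inv, inv_inv]
    ring

section Abstract

variable {W : Type*} [NormedAddCommGroup W] [InnerProductSpace ℝ W] {T : ℝ}

/-- The isometry `ψ ↦ (t ↦ ψ(t) w)` of `L²(0, T)` into `L²(0, T; W)`, for a unit vector `w`. -/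
noncomputable def timeEmbed (T : ℝ) {w : W} (hw : ‖w‖ = 1) :
    TimeL2 T →ₗᵢ[ℝ] Lp W 2 (volume.restrict (Set.Ioo 0 T)) where
  toLinearMap := ((ContinuousLinearMap.toSpanSingleton ℝ w).compLpL 2
    (volume.restrict (Set.Ioo 0 T))).toLinearMap
  norm_map' ψ := by
    rw [Lp.norm_def, Lp.norm_def]
    congr 1
    refine eLpNorm_congr_norm_ae ?_
    filter_upwards [(ContinuousLinearMap.toSpanSingleton ℝ w).coeFn_compLpL ψ] with t ht
    refine (congrArg norm ht).trans ?_
    simp [norm_smul, hw]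

lemma coeFn_timeEmbed {w : W} (hw : ‖w‖ = 1) (ψ : TimeL2 T) :
    ∀ᵐ t ∂(volume.restrict (Set.Ioo 0 T)), timeEmbed T hw ψ t = ψ t • w :=
  (ContinuousLinearMap.toSpanSingleton ℝ w).coeFn_compLpL ψ

/-- The coefficient map `f ↦ (t ↦ ⟨w, f(t)⟩)`. -/
noncomputable def timeCoeff (T : ℝ) (w : W) :
    Lp W 2 (volume.restrict (Set.Ioo 0 T)) →L[ℝ] TimeL2 T :=
  (innerSL ℝ w).compLpL 2 (volume.restrict (Set.Ioo 0 T))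

lemma coeFn_timeCoeff (w : W) (f : Lp W 2 (volume.restrict (Set.Ioo 0 T))) :
    ∀ᵐ t ∂(volume.restrict (Set.Ioo 0 T)), timeCoeff T w f t = inner ℝ w (f t) :=
  (innerSL ℝ w).coeFn_compLpL f

lemma inner_timeEmbed {w : W} (hw : ‖w‖ = 1) (ψ : TimeL2 T)
    (f : Lp W 2 (volume.restrict (Set.Ioo 0 T))) :
    inner ℝ (timeEmbed T hw ψ) f = inner ℝ ψ (timeCoeff T w f) := by
  rw [L2.inner_def, L2.inner_def]
  refine integral_congr_ae ?_
  filter_upwards [coeFn_timeEmbed hw ψ, coeFn_timeCoeff w f] with t h1 h2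
  rw [h1, h2, real_inner_smul_left]
  simp [mul_comm]

lemma inner_contTime_timeCoeff {g : ℝ → ℝ} (hg : Continuous g) (w : W)
    (f : Lp W 2 (volume.restrict (Set.Ioo 0 T))) :
    inner ℝ (contTime T g hg) (timeCoeff T w f) =
      ∫ t in Set.Ioo 0 T, g t * inner ℝ w (f t) := by
  rw [inner_contTime]
  refine integral_congr_ae ?_
  filter_upwards [coeFn_timeCoeff w f] with t ht
  rw [ht]

/-- The embedding `(ψ, g) ↦ (t ↦ ψ(t) φₙ, g φₙ)` of the `n`-th mode into `L²(0, T; W) × W`. -/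
noncomputable def modeEmbed (T : ℝ) (φ : HilbertBasis ℕ ℝ W) (n : ℕ) :
    WithLp 2 (TimeL2 T × ℝ) →ₗᵢ[ℝ]
      WithLp 2 (Lp W 2 (volume.restrict (Set.Ioo 0 T)) × W) :=
  LinearIsometry.withLpProdMap 2 (timeEmbed T (φ.orthonormal.1 n))
    (LinearIsometry.toSpanSingleton ℝ W (φ.orthonormal.1 n))

variable (φ : HilbertBasis ℕ ℝ W)

lemma ext_inner_hilbertBasis {v w : W} (h : ∀ n, inner ℝ (φ n) v = inner ℝ (φ n) w) : v = w := by
  apply φ.repr.injective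
  ext n
  rw [φ.repr_apply_apply, φ.repr_apply_apply, h]

lemma modeEmbed_fst (n : ℕ) (h : WithLp 2 (TimeL2 T × ℝ)) :
    (modeEmbed T φ n h).fst = timeEmbed T (φ.orthonormal.1 n) h.fst := rfl

lemma modeEmbed_snd (n : ℕ) (h : WithLp 2 (TimeL2 T × ℝ)) :
    (modeEmbed T φ n h).snd = h.snd • φ n := rfl

variable [CompleteSpace W]

lemma coord_modeEmbed (n : ℕ) (z : WithLp 2 (Lp W 2 (volume.restrict (Set.Ioo 0 T)) × W)) :
    coord (modeEmbed T φ) n z = WithLp.toLp 2 (timeCoeff T (φ n) z.fst, inner ℝ (φ n) z.snd) := by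
  refine ext_inner_left ℝ fun h => ?_
  rw [inner_coord, WithLp.prod_inner_apply, WithLp.prod_inner_apply]
  change inner ℝ (timeEmbed T (φ.orthonormal.1 n) h.fst) z.fst + inner ℝ (h.snd • φ n) z.snd =
    inner ℝ h.fst (timeCoeff T (φ n) z.fst) + inner ℝ h.snd (inner ℝ (φ n) z.snd)
  rw [inner_timeEmbed, real_inner_smul_left]
  simp [mul_comm]

lemma coord_modeEmbed_fst (n : ℕ) (z : WithLp 2 (Lp W 2 (volume.restrict (Set.Ioo 0 T)) × W)) :
    (coord (modeEmbed T φ) n z).fst = timeCoeff T (φ n) z.fst := by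
  rw [coord_modeEmbed]; rfl

lemma coord_modeEmbed_snd (n : ℕ) (z : WithLp 2 (Lp W 2 (volume.restrict (Set.Ioo 0 T)) × W)) :
    (coord (modeEmbed T φ) n z).snd = inner ℝ (φ n) z.snd := by
  rw [coord_modeEmbed]; rfl

/-- The modes are orthogonal and span the state space. -/
lemma isHilbertSum_modeEmbed :
    IsHilbertSum ℝ (fun _ : ℕ => WithLp 2 (TimeL2 T × ℝ)) (modeEmbed T φ) := by
  refine IsHilbertSum.mk (fun m n hmn h h' => ?_) ?_
  · rw [← inner_coord, coord_modeEmbed]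
    have hφ : inner ℝ (φ m) (φ n) = 0 := φ.orthonormal.2 hmn
    have h1 : timeCoeff T (φ m) (modeEmbed T φ n h').fst = 0 := by
      rw [Lp.ext_iff]
      filter_upwards [coeFn_timeCoeff (φ m) (modeEmbed T φ n h').fst,
        coeFn_timeEmbed (φ.orthonormal.1 n) h'.fst,
        Lp.coeFn_zero ℝ 2 (volume.restrict (Set.Ioo 0 T))] with t e1 e2 e3
      rw [e1, modeEmbed_fst, e2, e3, real_inner_smul_right, hφ, mul_zero]; rfl
    rw [h1, modeEmbed_snd, real_inner_smul_right, hφ, mul_zero]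
    exact inner_zero_right _
  · rw [top_le_iff, Submodule.topologicalClosure_eq_top_iff, eq_bot_iff]
    intro z hz
    have hc : ∀ n, coord (modeEmbed T φ) n z = 0 := fun n => ext_inner_left ℝ fun h => by
      rw [inner_coord, inner_zero_right]
      exact Submodule.inner_right_of_mem_orthogonal
        (Submodule.mem_iSup_of_mem n (LinearMap.mem_range_self _ h)) hz
    rw [Submodule.mem_bot]
    refine withLp_prod_ext ?_ ?_
    · rw [WithLp.zero_fst, Lp.ext_iff]
      have h1 : ∀ n, ∀ᵐ t ∂(volume.restrict (Set.Ioo 0 T)), inner ℝ (φ n) (z.fst t) = 0 :=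
        fun n => by
        have h2 : timeCoeff T (φ n) z.fst = 0 := by rw [← coord_modeEmbed_fst, hc]; rfl
        filter_upwards [coeFn_timeCoeff (φ n) z.fst,
          Lp.coeFn_zero ℝ 2 (volume.restrict (Set.Ioo 0 T))] with t e1 e2
        rw [← e1, h2, e2]; rfl
      filter_upwards [ae_all_iff.2 h1,
        Lp.coeFn_zero W 2 (volume.restrict (Set.Ioo 0 T))] with t e1 e2
      rw [e2]
      exact ext_inner_hilbertBasis φ fun n => by rw [e1]; simp
    · refine ext_inner_hilbertBasis φ fun n => ?_
      rw [← coord_modeEmbed_snd, hc]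
      simp

end Abstract

end BackwardHeat

namespace BackwardHeat

/-! ### The spectral calculus in coordinates -/

section Basis

variable {W : Type*} [NormedAddCommGroup W] [InnerProductSpace ℝ W] (φ : HilbertBasis ℕ ℝ W)

lemma hasSum_inner_sq (v : W) : HasSum (fun n => inner ℝ (φ n) v ^ 2) (‖v‖ ^ 2) := by
  have h := lp.hasSum_norm (p := 2) (by norm_num) (φ.repr v)
  simpa [φ.repr_apply_apply] using h

lemma exists_hasSum_smul_basis {a : ℕ → ℝ} (ha : Summable fun n => a n ^ 2) :
    ∃ v, HasSum (fun n => a n • φ n) v ∧ ∀ n, inner ℝ (φ n) v = a n := by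
  have hmem : Memℓp a 2 := by
    rw [memℓp_gen_iff (by norm_num)]
    simpa using ha
  refine ⟨φ.repr.symm ⟨a, hmem⟩, φ.hasSum_repr_symm ⟨a, hmem⟩, fun n => ?_⟩
  rw [← φ.repr_apply_apply, LinearIsometryEquiv.apply_symm_apply]

lemma inner_tsum_smul_basis {a : ℕ → ℝ} (ha : Summable fun n => a n ^ 2) (n : ℕ) :
    inner ℝ (φ n) (∑' m, a m • φ m) = a n := by
  obtain ⟨v, hv, h⟩ := exists_hasSum_smul_basis φ ha
  rw [hv.tsum_eq, h]

lemma summable_sq_mul_inner {c : ℕ → ℝ} {C : ℝ} (hc : ∀ n, |c n| ≤ C) (v : W) :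
    Summable fun n => (c n * inner ℝ (φ n) v) ^ 2 := by
  refine ((hasSum_inner_sq φ v).summable.mul_left (C ^ 2)).of_nonneg_of_le
    (fun _ => sq_nonneg _) fun n => ?_
  rw [mul_pow, ← sq_abs (c n)]
  gcongr
  exact hc n

end Basis

namespace Eigensystem

variable {d : ℕ} {Ω : Set (E d)} (e : Eigensystem Ω)

lemma inner_calculus {F : ℝ → ℝ} {C : ℝ} (hF : ∀ n, |F (e.μ n)⁻¹| ≤ C) (v : L2 Ω) (n : ℕ) :
    inner ℝ (e.φ n) (e.calculus F v) = F (e.μ n)⁻¹ * inner ℝ (e.φ n) v :=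
  inner_tsum_smul_basis e.φ (summable_sq_mul_inner e.φ hF v) n

lemma inner_invA {C : ℝ} (hC : ∀ n, |e.μ n| ≤ C) (v : L2 Ω) (n : ℕ) :
    inner ℝ (e.φ n) (e.invA v) = e.μ n * inner ℝ (e.φ n) v := by
  rw [invA, e.inner_calculus (C := C) (fun n => by rw [inv_inv]; exact hC n), inv_inv]

variable {e} (hμ : ∀ n, 0 < e.μ n)
include hμ

lemma abs_exp_neg_le_one {τ : ℝ} (hτ : 0 ≤ τ) (n : ℕ) :
    |Real.exp (-((e.μ n)⁻¹ * τ))| ≤ 1 := by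
  rw [abs_of_pos (Real.exp_pos _), Real.exp_le_one_iff]
  have := mul_nonneg (inv_pos.2 (hμ n)).le hτ
  linarith

lemma inner_heat {τ : ℝ} (hτ : 0 ≤ τ) (v : L2 Ω) (n : ℕ) :
    inner ℝ (e.φ n) (e.heat τ v) = Real.exp (-((e.μ n)⁻¹ * τ)) * inner ℝ (e.φ n) v :=
  e.inner_calculus (F := fun γ => Real.exp (-(γ * τ))) (abs_exp_neg_le_one hμ hτ) v n

lemma inner_heatSqrt {τ : ℝ} (hτ : 0 < τ) (v : L2 Ω) (n : ℕ) :
    inner ℝ (e.φ n) (e.heatSqrt τ v) =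
      Real.exp (-((e.μ n)⁻¹ * τ)) * √(e.μ n)⁻¹ * inner ℝ (e.φ n) v := by
  refine e.inner_calculus (F := fun γ => Real.exp (-(γ * τ)) * √γ) (C := 1 + τ⁻¹) (fun m => ?_) v n
  have hγ : 0 < (e.μ m)⁻¹ := inv_pos.2 (hμ m)
  generalize (e.μ m)⁻¹ = γ at hγ
  -- `√γ ≤ 1 + γ ≤ (1 + γ τ) (1 + 1 / τ) ≤ e^{γ τ} (1 + 1 / τ)`
  rw [abs_of_nonneg (by positivity), Real.exp_neg, inv_mul_le_iff₀ (Real.exp_pos _)]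
  have h1 : √γ ≤ 1 + γ := by nlinarith [Real.sq_sqrt hγ.le, sq_nonneg (√γ - 1)]
  have h2 : (1 + γ * τ) * (1 + τ⁻¹) = 1 + τ⁻¹ + γ * τ + γ := by field_simp; ring
  have h3 : γ * τ + 1 ≤ Real.exp (γ * τ) := Real.add_one_le_exp _
  have h4 : (1 + γ * τ) * (1 + τ⁻¹) ≤ Real.exp (γ * τ) * (1 + τ⁻¹) := by gcongr; linarith
  have h5 : 0 < τ⁻¹ := inv_pos.2 hτ
  have h6 : 0 < γ * τ := mul_pos hγ hτ
  linarith

/-- The coefficients of the integral are square summable because `‖e^{-(T-·)/μ}‖² ≤ μ` compensates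
the factor `1 / μ` that comes from `A^{1/2}`. -/
lemma inner_heatSqrtIntegral {T : ℝ} (hT : 0 < T) (f : L2Time T Ω) (n : ℕ) :
    inner ℝ (e.φ n) (e.heatSqrtIntegral T f) =
      √(e.μ n)⁻¹ * inner ℝ (expTime T (e.μ n)) (timeCoeff T (e.φ n) f) := by
  have hcoef : ∀ m, ∫ s in Set.Ioo 0 T, Real.exp (-((e.μ m)⁻¹ * (T - s))) * √((e.μ m)⁻¹) *
      inner ℝ (e.φ m) (f s) =
      √(e.μ m)⁻¹ * inner ℝ (expTime T (e.μ m)) (timeCoeff T (e.φ m) f) := fun m => by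
    rw [expTime, inner_contTime_timeCoeff, ← integral_const_mul]
    congr 1
    ext s
    ring
  rw [heatSqrtIntegral]
  simp only [hcoef]
  refine inner_tsum_smul_basis e.φ (a := fun m =>
    √(e.μ m)⁻¹ * inner ℝ (expTime T (e.μ m)) (timeCoeff T (e.φ m) f)) ?_ n
  have hs := (hasSum_norm_sq_coord (isHilbertSum_modeEmbed (T := T) e.φ)
    (WithLp.toLp 2 (f, 0))).summable
  refine hs.of_nonneg_of_le (fun _ => sq_nonneg _) fun m => ?_
  have h1 : ‖timeCoeff T (e.φ m) f‖ ≤ ‖coord (modeEmbed T e.φ) m (WithLp.toLp 2 (f, 0))‖ := by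
    have := norm_fst_le (coord (modeEmbed T e.φ) m (WithLp.toLp 2 (f, 0)))
    rwa [coord_modeEmbed_fst] at this
  refine le_trans ?_ (pow_le_pow_left₀ (norm_nonneg _) h1 2)
  have hγ : 0 < (e.μ m)⁻¹ := inv_pos.2 (hμ m)
  rw [mul_pow, Real.sq_sqrt hγ.le]
  have h2 : inner ℝ (expTime T (e.μ m)) (timeCoeff T (e.φ m) f) ^ 2 ≤
      ‖expTime T (e.μ m)‖ ^ 2 * ‖timeCoeff T (e.φ m) f‖ ^ 2 := by
    rw [← mul_pow]
    exact sq_le_sq' (neg_le_of_abs_le (abs_real_inner_le_norm _ _)) (real_inner_le_norm _ _)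
  have h3 : (e.μ m)⁻¹ * ‖expTime T (e.μ m)‖ ^ 2 ≤ 1 := by
    rw [← real_inner_self_eq_norm_sq, (isModePair_time hT (hμ m)).inner_ee,
      inv_mul_le_iff₀ (hμ m)]
    nlinarith [hμ m, sq_nonneg (Real.exp (-(T / e.μ m)))]
  calc (e.μ m)⁻¹ * inner ℝ (expTime T (e.μ m)) (timeCoeff T (e.φ m) f) ^ 2
      ≤ (e.μ m)⁻¹ * (‖expTime T (e.μ m)‖ ^ 2 * ‖timeCoeff T (e.φ m) f‖ ^ 2) := by gcongr
    _ = ((e.μ m)⁻¹ * ‖expTime T (e.μ m)‖ ^ 2) * ‖timeCoeff T (e.φ m) f‖ ^ 2 := by ring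
    _ ≤ 1 * ‖timeCoeff T (e.φ m) f‖ ^ 2 := by gcongr
    _ = _ := one_mul _

lemma norm_heat_le {τ : ℝ} (hτ : 0 ≤ τ) (v : L2 Ω) : ‖e.heat τ v‖ ≤ ‖v‖ := by
  refine abs_le_of_sq_le_sq' ?_ (norm_nonneg _) |>.2
  refine hasSum_le (fun n => ?_) (hasSum_inner_sq e.φ (e.heat τ v)) (hasSum_inner_sq e.φ v)
  rw [inner_heat hμ hτ, mul_pow]
  refine mul_le_of_le_one_left (sq_nonneg _) ?_
  rw [← sq_abs]
  exact pow_le_one₀ (abs_nonneg _) (abs_exp_neg_le_one hμ hτ n)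

/-- Measurability holds because the integrand is the pointwise limit of its partial sums. -/
lemma integrable_heat {T : ℝ} (f : L2Time T Ω) :
    Integrable (fun s => e.heat (T - s) (f s)) (volume.restrict (Set.Ioo 0 T)) := by
  have hf : Integrable f (volume.restrict (Set.Ioo 0 T)) :=
    (Lp.memLp f).integrable (by norm_num)
  refine hf.mono ?_ ?_
  · refine aestronglyMeasurable_of_tendsto_ae atTop (f := fun N s => ∑ n ∈ Finset.range N,
      (Real.exp (-((e.μ n)⁻¹ * (T - s))) * inner ℝ (e.φ n) (f s)) • e.φ n) (fun N => ?_) ?_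
    · refine Finset.aestronglyMeasurable_fun_sum _ fun n _ => ?_
      refine AEStronglyMeasurable.smul_const (AEStronglyMeasurable.mul ?_ ?_) _
      · exact Continuous.aestronglyMeasurable (by fun_prop)
      · exact (aestronglyMeasurable_const).inner (Lp.aestronglyMeasurable f)
    · filter_upwards [ae_restrict_mem measurableSet_Ioo] with s hs
      obtain ⟨v, hv, -⟩ := exists_hasSum_smul_basis e.φ (summable_sq_mul_inner e.φ
        (abs_exp_neg_le_one hμ (sub_nonneg.2 hs.2.le)) (f s))
      have : e.heat (T - s) (f s) = v := hv.tsum_eq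
      rw [this]
      exact hv.tendsto_sum_nat
  · filter_upwards [ae_restrict_mem measurableSet_Ioo] with s hs
    exact norm_heat_le hμ (sub_nonneg.2 hs.2.le) _

end Eigensystem

/-! ### The all-at-once operators -/

lemma coeFn_modeOp_fst (T μ s : ℝ) (h : WithLp 2 (TimeL2 T × ℝ)) :
    ∀ᵐ t ∂(volume.restrict (Set.Ioo 0 T)),
      (modeOp (oneTime T) (expTime T μ) μ⁻¹ s h).fst t = h.fst t +
        μ⁻¹ * inner ℝ (expTime T μ) h.fst * Real.exp (-(μ⁻¹ * (T - t))) +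
        h.snd * (1 + Real.exp (-(μ⁻¹ * (T - t)))) := by
  rw [modeOp_fst]
  filter_upwards [Lp.coeFn_add (h.fst + (μ⁻¹ * inner ℝ (expTime T μ) h.fst) • expTime T μ)
      (h.snd • (oneTime T + expTime T μ)),
    Lp.coeFn_add h.fst ((μ⁻¹ * inner ℝ (expTime T μ) h.fst) • expTime T μ),
    Lp.coeFn_smul (μ⁻¹ * inner ℝ (expTime T μ) h.fst) (expTime T μ),
    Lp.coeFn_smul h.snd (oneTime T + expTime T μ), Lp.coeFn_add (oneTime T) (expTime T μ),
    coeFn_contTime T (f := fun _ => 1) continuous_const,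
    coeFn_contTime T (f := fun t => Real.exp (-(μ⁻¹ * (T - t)))) (by fun_prop)]
    with t h1 h2 h3 h4 h5 h6 h7
  rw [h1, Pi.add_apply, h2, Pi.add_apply, h3, Pi.smul_apply, h4, Pi.smul_apply, h5, Pi.add_apply,
    oneTime, h6, smul_eq_mul, smul_eq_mul]
  congr 2 <;> congr 2

lemma coeFn_modeOp₀_fst (T μ s : ℝ) (h : WithLp 2 (TimeL2 T × ℝ)) :
    ∀ᵐ t ∂(volume.restrict (Set.Ioo 0 T)),
      (modeOp₀ (oneTime T) (expTime T μ) μ⁻¹ s h).fst t = h.fst t +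
        μ⁻¹ * inner ℝ (expTime T μ) h.fst * Real.exp (-(μ⁻¹ * (T - t))) + h.snd := by
  rw [modeOp₀_fst]
  filter_upwards [Lp.coeFn_add (h.fst + (μ⁻¹ * inner ℝ (expTime T μ) h.fst) • expTime T μ)
      (h.snd • oneTime T),
    Lp.coeFn_add h.fst ((μ⁻¹ * inner ℝ (expTime T μ) h.fst) • expTime T μ),
    Lp.coeFn_smul (μ⁻¹ * inner ℝ (expTime T μ) h.fst) (expTime T μ),
    Lp.coeFn_smul h.snd (oneTime T),
    coeFn_contTime T (f := fun _ => 1) continuous_const,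
    coeFn_contTime T (f := fun t => Real.exp (-(μ⁻¹ * (T - t)))) (by fun_prop)]
    with t h1 h2 h3 h4 h6 h7
  rw [h1, Pi.add_apply, h2, Pi.add_apply, h3, Pi.smul_apply, h4, Pi.smul_apply,
    oneTime, h6, smul_eq_mul, smul_eq_mul, mul_one]
  congr 3

namespace Eigensystem

variable {d : ℕ} {Ω : Set (E d)}

lemma inner_opD {e : Eigensystem Ω} (hμ : ∀ n, 0 < e.μ n) {T : ℝ} (hT : 0 < T) (f : L2Time T Ω)
    {t : ℝ} (ht : t < T) (n : ℕ) : inner ℝ (e.φ n) (e.opD T f t) =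
      (e.μ n)⁻¹ * inner ℝ (expTime T (e.μ n)) (timeCoeff T (e.φ n) f) *
        Real.exp (-((e.μ n)⁻¹ * (T - t))) := by
  rw [opD, inner_heatSqrt hμ (sub_pos.2 ht), inner_heatSqrtIntegral hμ hT]
  have h := Real.mul_self_sqrt (inv_pos.2 (hμ n)).le
  linear_combination (Real.exp (-((e.μ n)⁻¹ * (T - t))) *
    inner ℝ (expTime T (e.μ n)) (timeCoeff T (e.φ n) f)) * h

lemma inner_integral_fst (e : Eigensystem Ω) {T : ℝ} (f : L2Time T Ω) (n : ℕ) :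
    inner ℝ (e.φ n) (∫ s in Set.Ioo 0 T, f s) =
      inner ℝ (oneTime T) (timeCoeff T (e.φ n) f) := by
  have hf : Integrable f (volume.restrict (Set.Ioo 0 T)) :=
    (Lp.memLp f).integrable (by norm_num)
  rw [oneTime, inner_contTime_timeCoeff, ← integral_inner hf]
  simp

/-- The blocks `modeOp` describe the action of `G` on the coefficients with respect to `φₙ`. -/
lemma isTransformedOperator_of_isBlockDiagonal {e : Eigensystem Ω} (hμ : ∀ n, 0 < e.μ n) {C : ℝ}
    (hC : ∀ n, |e.μ n| ≤ C) {T : ℝ} (hT : 0 < T) {G : Z T Ω →L[ℝ] Z T Ω}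
    (hG : IsBlockDiagonal (modeEmbed T e.φ)
      (fun n => modeOp (oneTime T) (expTime T (e.μ n)) (e.μ n)⁻¹ (T + e.μ n)) G) :
    e.IsTransformedOperator T G := by
  refine fun z => ⟨?_, ?_⟩
  · have hn : ∀ n, ∀ᵐ t ∂(volume.restrict (Set.Ioo 0 T)), inner ℝ (e.φ n) ((G z).fst t) =
        inner ℝ (e.φ n) ((z.fst t + e.opD T z.fst t) + (z.snd + e.heat (T - t) z.snd)) := by
      intro n
      have h0 := coeFn_timeCoeff (e.φ n) (G z).fst
      rw [← coord_modeEmbed_fst, hG] at h0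
      filter_upwards [h0, coeFn_modeOp_fst T (e.μ n) (T + e.μ n) (coord (modeEmbed T e.φ) n z),
        coeFn_timeCoeff (e.φ n) z.fst, ae_restrict_mem measurableSet_Ioo] with t h1 h2 h3 ht
      rw [← h1, h2, coord_modeEmbed_fst, coord_modeEmbed_snd, h3, inner_add_right,
        inner_add_right, inner_add_right, inner_opD hμ hT _ ht.2,
        inner_heat hμ (sub_nonneg.2 ht.2.le)]
      ring
    filter_upwards [ae_all_iff.2 hn] with t ht
    exact ext_inner_hilbertBasis e.φ ht
  · refine ext_inner_hilbertBasis e.φ fun n => ?_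
    rw [← coord_modeEmbed_snd, hG, modeOp_snd, coord_modeEmbed_fst, coord_modeEmbed_snd,
      inner_add_right, inner_add_right, inner_add_right, e.inner_integral_fst,
      e.inner_invA hC, real_inner_smul_right, ← integral_inner (integrable_heat hμ z.fst)]
    have h1 : ∫ s in Set.Ioo 0 T, inner ℝ (e.φ n) (e.heat (T - s) (z.fst s)) =
        inner ℝ (expTime T (e.μ n)) (timeCoeff T (e.φ n) z.fst) := by
      rw [expTime, inner_contTime_timeCoeff]
      refine setIntegral_congr_fun measurableSet_Ioo fun s hs => ?_
      exact inner_heat hμ (sub_nonneg.2 hs.2.le) _ n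
    rw [h1]
    ring

lemma isUnperturbedOperator_of_isBlockDiagonal {e : Eigensystem Ω} (hμ : ∀ n, 0 < e.μ n)
    {T : ℝ} (hT : 0 < T) {G : Z T Ω →L[ℝ] Z T Ω}
    (hG : IsBlockDiagonal (modeEmbed T e.φ)
      (fun n => modeOp₀ (oneTime T) (expTime T (e.μ n)) (e.μ n)⁻¹ T) G) :
    e.IsUnperturbedOperator T G := by
  refine fun z => ⟨?_, ?_⟩
  · have hn : ∀ n, ∀ᵐ t ∂(volume.restrict (Set.Ioo 0 T)), inner ℝ (e.φ n) ((G z).fst t) =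
        inner ℝ (e.φ n) ((z.fst t + e.opD T z.fst t) + z.snd) := by
      intro n
      have h0 := coeFn_timeCoeff (e.φ n) (G z).fst
      rw [← coord_modeEmbed_fst, hG] at h0
      filter_upwards [h0, coeFn_modeOp₀_fst T (e.μ n) T (coord (modeEmbed T e.φ) n z),
        coeFn_timeCoeff (e.φ n) z.fst, ae_restrict_mem measurableSet_Ioo] with t h1 h2 h3 ht
      rw [← h1, h2, coord_modeEmbed_fst, coord_modeEmbed_snd, h3, inner_add_right,
        inner_add_right, inner_opD hμ hT _ ht.2]
    filter_upwards [ae_all_iff.2 hn] with t ht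
    exact ext_inner_hilbertBasis e.φ ht
  · refine ext_inner_hilbertBasis e.φ fun n => ?_
    rw [← coord_modeEmbed_snd, hG, modeOp₀_snd, coord_modeEmbed_fst, coord_modeEmbed_snd,
      inner_add_right, e.inner_integral_fst, real_inner_smul_right]

end Eigensystem

end BackwardHeat

namespace BackwardHeat

/-! ### Eigenvalues and spectrum of the all-at-once operator -/

section Mode

variable {Y : Type*} [NormedAddCommGroup Y] [InnerProductSpace ℝ Y] {T μ : ℝ} {b e : Y}

/-- `modeOp - 1` takes its values in the span of `(b, 0)`, `(e, 0)`, `(0, 1)`, which are independent. -/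
lemma IsModePair.modeOp_eq_self_iff (hbe : IsModePair T μ b e) (hT : 0 < T) (hμ : 0 < μ) {s : ℝ}
    (h : WithLp 2 (Y × ℝ)) : modeOp b e μ⁻¹ s h = h ↔
      inner ℝ b h.fst = 0 ∧ inner ℝ e h.fst = 0 ∧ h.snd = 0 := by
  rw [← sub_eq_zero, modeOp_sub_self]
  constructor
  · intro h0
    obtain ⟨h1, h2, h3⟩ := hbe.modeVec_eq_zero hT hμ h0
    rw [h1, zero_add, mul_eq_zero_iff_left (inv_ne_zero hμ.ne')] at h2
    rw [h1, h2, mul_zero, add_zero, add_zero] at h3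
    exact ⟨h3, h2, h1⟩
  · rintro ⟨h1, h2, h3⟩
    rw [h1, h2, h3]
    refine withLp_prod_ext ?_ ?_
    · rw [modeVec_fst]; simp
    · rw [modeVec_snd]; simp

lemma IsModePair.norm_sq_le (hbe : IsModePair T μ b e) (hμ : 0 < μ) : ‖e‖ ^ 2 ≤ μ := by
  rw [← real_inner_self_eq_norm_sq, hbe.inner_ee]
  nlinarith [sq_nonneg (Real.exp (-(T / μ)))]

lemma IsModePair.norm_modeOp_le (hbe : IsModePair T μ b e) (hT : 0 < T) (hμ : 0 < μ) :
    ‖modeOp b e μ⁻¹ (T + μ)‖ ≤ 4 + 2 * √T + T + 3 * μ := by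
  refine (BackwardHeat.norm_modeOp_le b e _ _ (inv_pos.2 hμ).le).trans ?_
  have h1 := hbe.norm_sq_le hμ
  have h2 : μ⁻¹ * ‖e‖ ^ 2 ≤ 1 := by rwa [inv_mul_le_iff₀ hμ, mul_one]
  have h3 : ‖b‖ = √T := by rw [← hbe.inner_bb, real_inner_self_eq_norm_sq, Real.sqrt_sq (norm_nonneg _)]
  have h4 : ‖e‖ ≤ 1 + μ := by nlinarith [sq_nonneg (‖e‖ - 1)]
  rw [h3, abs_of_pos (by positivity)]
  linarith

/-- The inverse of `l - A` on a single mode, for `l ≠ 1` that is not a root of the cubic. -/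
noncomputable def modeResolvent (b e : Y) (T μ l : ℝ) :
    WithLp 2 (Y × ℝ) →L[ℝ] WithLp 2 (Y × ℝ) :=
  cubicResolvent (modeOp b e μ⁻¹ (T + μ)) (T + 5 / 2 + alpha T μ) (3 / 2 * (T + 1) + beta T μ)
    (μ * Real.exp (-(2 * T / μ))) l

lemma IsModePair.modeResolvent_mul (hbe : IsModePair T μ b e) (hμ : 0 < μ) {l : ℝ}
    (hl : cubic T μ l ≠ 0) (hl1 : l ≠ 1) :
    (algebraMap ℝ (WithLp 2 (Y × ℝ) →L[ℝ] WithLp 2 (Y × ℝ)) l - modeOp b e μ⁻¹ (T + μ)) *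
        modeResolvent b e T μ l = 1 ∧
      modeResolvent b e T μ l *
        (algebraMap ℝ (WithLp 2 (Y × ℝ) →L[ℝ] WithLp 2 (Y × ℝ)) l - modeOp b e μ⁻¹ (T + μ)) = 1 :=
  cubicResolvent_mul (hbe.cubic_modeOp_eq_zero hμ.ne' rfl) hl hl1

end Mode

lemma tendsto_cubic {T : ℝ} (hT : 0 < T) (l : ℝ) :
    Tendsto (fun μ => cubic T μ l) (𝓝[>] 0) (𝓝 (l * (l - 3 / 2) * (l - (T + 1)))) := by
  have h := (((((tendsto_alpha hT).const_add (T + 5 / 2)).const_mul (l ^ 2)).const_sub (l ^ 3)).add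
    (((tendsto_beta hT).const_add (3 / 2 * (T + 1))).const_mul l)).sub
    (tendsto_id_nhdsGT_zero.mul (tendsto_exp_neg_div (by positivity : 0 < 2 * T)))
  convert! h using 2
  ring

lemma isBigO_one_top_of_tendsto {u : ℕ → ℝ} {a : ℝ} (h : Tendsto u atTop (𝓝 a)) :
    u =O[⊤] (fun _ => (1 : ℝ)) := by
  obtain ⟨C, hC⟩ := (Metric.isBounded_range_of_tendsto u h).exists_norm_le
  exact isBigO_top.2 ⟨C, fun n => by simpa using hC _ (Set.mem_range_self n)⟩

/-- The coefficients of the resolvents converge as `μ → 0`, so the resolvents are bounded. -/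
lemma exists_norm_cubicResolvent_le {R : Type*} [NormedRing R] [NormedAlgebra ℝ R] {A : ℕ → R}
    {u v w : ℕ → ℝ} {u₀ v₀ l c : ℝ} (hA : A =O[⊤] (fun _ => (1 : ℝ)))
    (hu : Tendsto u atTop (𝓝 u₀)) (hv : Tendsto v atTop (𝓝 v₀))
    (hc : Tendsto (fun n => l ^ 3 - l ^ 2 * u n + l * v n - w n) atTop (𝓝 c)) (hc0 : c ≠ 0) :
    ∃ K, ∀ n, ‖cubicResolvent (A n) (u n) (v n) (w n) l‖ ≤ K := by
  have mul : ∀ {f g : ℕ → R}, f =O[⊤] (fun _ => (1 : ℝ)) → g =O[⊤] (fun _ => (1 : ℝ)) →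
      (fun n => f n * g n) =O[⊤] (fun _ => (1 : ℝ)) := fun hf hg => by
    simpa using hf.mul hg
  have smul : ∀ {r : ℕ → ℝ} {f : ℕ → R}, r =O[⊤] (fun _ => (1 : ℝ)) →
      f =O[⊤] (fun _ => (1 : ℝ)) → (fun n => r n • f n) =O[⊤] (fun _ => (1 : ℝ)) :=
    fun hr hf => by simpa using hr.smul hf
  have one : (fun _ : ℕ => (1 : R)) =O[⊤] (fun _ => (1 : ℝ)) :=
    isBigO_top.2 ⟨‖(1 : R)‖, fun n => by simp⟩
  have h1 := isBigO_one_top_of_tendsto (hc.inv₀ hc0)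
  have h2 := isBigO_one_top_of_tendsto (hu.const_sub l)
  have h3 := isBigO_one_top_of_tendsto (((hu.const_mul l).const_sub (l ^ 2)).add hv)
  have h4 : (fun n => A n ^ 2) =O[⊤] (fun _ => (1 : ℝ)) := by simpa [sq] using mul hA hA
  have h5 := smul (isBigO_one_top_of_tendsto tendsto_const_nhds (u := fun _ => (l - 1)⁻¹))
    (one.add (smul h1 (mul (hA.sub one) ((h4.add (smul h2 hA)).add (smul h3 one)))))
  obtain ⟨K, hK⟩ := isBigO_top.1 h5
  exact ⟨K, fun n => by simpa [cubicResolvent] using hK n⟩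

namespace Eigensystem

variable {d : ℕ} {Ω : Set (E d)} (e : Eigensystem Ω) (T : ℝ)

/-- The blocks of `G` with respect to the embeddings `modeEmbed`. -/
noncomputable def block (n : ℕ) :
    WithLp 2 (TimeL2 T × ℝ) →L[ℝ] WithLp 2 (TimeL2 T × ℝ) :=
  modeOp (oneTime T) (expTime T (e.μ n)) (e.μ n)⁻¹ (T + e.μ n)

/-- The blocks of `G₀` with respect to the embeddings `modeEmbed`. -/
noncomputable def block₀ (n : ℕ) :
    WithLp 2 (TimeL2 T × ℝ) →L[ℝ] WithLp 2 (TimeL2 T × ℝ) :=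
  modeOp₀ (oneTime T) (expTime T (e.μ n)) (e.μ n)⁻¹ T

variable {e T} (hμ : ∀ n, 0 < e.μ n) (hT : 0 < T)
include hμ hT

lemma exists_norm_block_le (hlim : Tendsto e.μ atTop (𝓝 0)) : ∃ K, ∀ n, ‖e.block T n‖ ≤ K := by
  obtain ⟨C, hC⟩ := isBigO_top.1 (isBigO_one_top_of_tendsto hlim)
  refine ⟨4 + 2 * √T + T + 3 * C, fun n => ?_⟩
  refine ((isModePair_time hT (hμ n)).norm_modeOp_le hT (hμ n)).trans ?_
  have h := hC n
  simp only [norm_one, mul_one, Real.norm_eq_abs, abs_of_pos (hμ n)] at h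
  linarith

lemma tendsto_norm_block_sub (hlim : Tendsto e.μ atTop (𝓝 0)) :
    Tendsto (fun n => ‖e.block T n - e.block₀ T n‖) atTop (𝓝 0) := by
  have h1 : Tendsto (fun n => 2 * √(e.μ n) + e.μ n) atTop (𝓝 0) := by
    simpa using (hlim.sqrt.const_mul 2).add hlim
  refine squeeze_zero (fun _ => norm_nonneg _) (fun n => ?_) h1
  refine (norm_modeOp_sub_le _ _ _ _ _).trans ?_
  rw [add_sub_cancel_left, abs_of_pos (hμ n)]
  gcongr
  exact Real.le_sqrt_of_sq_le ((isModePair_time hT (hμ n)).norm_sq_le (hμ n))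

variable {G : Z T Ω →L[ℝ] Z T Ω} (hG : IsBlockDiagonal (modeEmbed T e.φ) (e.block T) G)

omit hμ hT in
lemma unitEigenvectors_iff {z : Z T Ω} : z ∈ e.unitEigenvectors T ↔
    ∃ (m : ℕ) (ψ : TimeL2 T), inner ℝ (oneTime T) ψ = 0 ∧ inner ℝ (expTime T (e.μ m)) ψ = 0 ∧
      z = modeEmbed T e.φ m (WithLp.toLp 2 (ψ, 0)) := by
  have h1 : ∀ ψ : TimeL2 T, inner ℝ (oneTime T) ψ = ∫ t in Set.Ioo 0 T, ψ t := fun ψ => by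
    rw [oneTime, inner_contTime]; simp
  have h2 : ∀ m (ψ : TimeL2 T), inner ℝ (expTime T (e.μ m)) ψ =
      ∫ t in Set.Ioo 0 T, Real.exp (-((e.μ m)⁻¹ * (T - t))) * ψ t := fun m ψ => by
    rw [expTime, inner_contTime]
  constructor
  · rintro ⟨m, ψ, e1, e2, e3, e4⟩
    refine ⟨m, ψ, by rw [h1, e1], by rw [h2, e2], withLp_prod_ext ?_ ?_⟩
    · rw [modeEmbed_fst, Lp.ext_iff]
      filter_upwards [e3, coeFn_timeEmbed (e.φ.orthonormal.1 m) ψ] with t h3 h4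
      rw [h3]
      exact h4.symm
    · rw [modeEmbed_snd, e4]; simp
  · rintro ⟨m, ψ, e1, e2, rfl⟩
    refine ⟨m, ψ, by rw [← h1, e1], by rw [← h2, e2], ?_, ?_⟩
    · rw [modeEmbed_fst]
      exact coeFn_timeEmbed (e.φ.orthonormal.1 m) ψ
    · rw [modeEmbed_snd]; simp

include hG

lemma apply_eq_self_iff (z : Z T Ω) : G z = z ↔
    ∀ n, inner ℝ (oneTime T) (coord (modeEmbed T e.φ) n z).fst = 0 ∧
      inner ℝ (expTime T (e.μ n)) (coord (modeEmbed T e.φ) n z).fst = 0 ∧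
      (coord (modeEmbed T e.φ) n z).snd = 0 := by
  have h : ∀ n, e.block T n (coord (modeEmbed T e.φ) n z) = coord (modeEmbed T e.φ) n z ↔ _ :=
    fun n => (isModePair_time hT (hμ n)).modeOp_eq_self_iff hT (hμ n) _
  simp only [← h]
  constructor
  · intro hz n
    rw [← hG, hz]
  · intro hz
    exact ext_coord (isHilbertSum_modeEmbed e.φ) fun n => by rw [hG, hz]

lemma mem_eigenspace_of_mem_unitEigenvectors {z : Z T Ω} (hz : z ∈ e.unitEigenvectors T) :
    G z = z := by
  obtain ⟨m, ψ, h1, h2, rfl⟩ := unitEigenvectors_iff.1 hz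
  rw [hG.apply_V (isHilbertSum_modeEmbed e.φ)]
  congr 1
  exact ((isModePair_time hT (hμ m)).modeOp_eq_self_iff hT (hμ m) _).2 ⟨h1, h2, rfl⟩

/-- An eigenvector for `1` is the sum of its modes, which are among the generators. -/
lemma eigenspace_one_eq : Module.End.eigenspace (G : Z T Ω →ₗ[ℝ] Z T Ω) 1 =
    (Submodule.span ℝ (e.unitEigenvectors T)).topologicalClosure := by
  have hmem : ∀ z, z ∈ Module.End.eigenspace (G : Z T Ω →ₗ[ℝ] Z T Ω) 1 ↔ G z = z := fun z => by
    rw [Module.End.mem_eigenspace_iff, one_smul]; rfl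
  refine le_antisymm (fun z hz => ?_) (Submodule.topologicalClosure_minimal _
    (Submodule.span_le.2 fun z hz =>
      (hmem z).2 (mem_eigenspace_of_mem_unitEigenvectors hμ hT hG hz)) ?_)
  · rw [hmem, apply_eq_self_iff hμ hT hG] at hz
    refine mem_closure_of_tendsto (hasSum_coord (isHilbertSum_modeEmbed e.φ) z)
      (Eventually.of_forall fun s => Submodule.sum_mem _ fun n _ => Submodule.subset_span ?_)
    obtain ⟨h1, h2, h3⟩ := hz n
    exact unitEigenvectors_iff.2 ⟨n, _, h1, h2, congrArg _ (withLp_prod_ext rfl h3)⟩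
  · have : ((Module.End.eigenspace (G : Z T Ω →ₗ[ℝ] Z T Ω) 1 : Submodule ℝ (Z T Ω)) :
        Set (Z T Ω)) = {z | G z = z} := Set.ext hmem
    rw [this]
    exact isClosed_eq G.continuous continuous_id

/-- The eigenspace contains a copy of a subspace of `L²(0, T)` of codimension two. -/
lemma not_finiteDimensional_eigenspace_one :
    ¬ FiniteDimensional ℝ (Module.End.eigenspace (G : Z T Ω →ₗ[ℝ] Z T Ω) 1) := by
  intro hfd
  set S : Submodule ℝ (TimeL2 T) := Submodule.span ℝ {oneTime T, expTime T (e.μ 0)}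
  have hS : FiniteDimensional ℝ S := FiniteDimensional.span_of_finite ℝ (by simp)
  have hmemS : ∀ ψ ∈ Sᗮ, modeEmbed T e.φ 0 (WithLp.toLp 2 (ψ, 0)) ∈ e.unitEigenvectors T :=
    fun ψ hψ => unitEigenvectors_iff.2 ⟨0, ψ,
      Submodule.inner_right_of_mem_orthogonal (Submodule.subset_span (by simp)) hψ,
      Submodule.inner_right_of_mem_orthogonal (Submodule.subset_span (by simp)) hψ, rfl⟩
  let L : Sᗮ →ₗ[ℝ] Module.End.eigenspace (G : Z T Ω →ₗ[ℝ] Z T Ω) 1 :=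
    LinearMap.codRestrict _ ((modeEmbed T e.φ 0).toLinearMap ∘ₗ
      (WithLp.linearEquiv 2 ℝ (TimeL2 T × ℝ)).symm.toLinearMap ∘ₗ
        LinearMap.inl ℝ (TimeL2 T) ℝ ∘ₗ Sᗮ.subtype) fun ψ => by
      rw [Module.End.mem_eigenspace_iff, one_smul]
      exact mem_eigenspace_of_mem_unitEigenvectors hμ hT hG (hmemS ψ.1 ψ.2)
  have hL : Function.Injective L := fun ψ χ h => by
    have h1 := (modeEmbed T e.φ 0).injective (congrArg Subtype.val h)
    exact Subtype.ext (congrArg WithLp.fst h1)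
  have hS' : FiniteDimensional ℝ Sᗮ := FiniteDimensional.of_injective L hL
  have htop : FiniteDimensional ℝ (S ⊔ Sᗮ : Submodule ℝ (TimeL2 T)) := inferInstance
  rw [Submodule.sup_orthogonal_of_hasOrthogonalProjection] at htop
  refine not_finiteDimensional_Lp (μ := volume) isOpen_Ioo (Set.Ioo_infinite hT) (by simp) ?_
  exact Module.Finite.equiv (Submodule.topEquiv (R := ℝ) (M := TimeL2 T))

/-- Apart from `1` and the roots of the cubics, every block has a resolvent, so an eigenvector has only
zero modes. -/
lemma hasEigenvalue_iff (l : ℝ) :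
    Module.End.HasEigenvalue (G : Z T Ω →ₗ[ℝ] Z T Ω) l ↔ l = 1 ∨ ∃ m, cubic T (e.μ m) l = 0 := by
  constructor
  · intro hl
    by_contra! hne
    obtain ⟨z, hz, hz0⟩ := hl.exists_hasEigenvector
    have hGz : G z = l • z := Module.End.mem_eigenspace_iff.1 hz
    refine hz0 (ext_coord (isHilbertSum_modeEmbed e.φ) fun n => ?_)
    have hinv := ((isModePair_time hT (hμ n)).modeResolvent_mul (hμ n) (hne.2 n) hne.1).2
    have hker : (algebraMap ℝ _ l - e.block T n) (coord (modeEmbed T e.φ) n z) = 0 := by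
      rw [sub_apply, ← hG, hGz, map_smul]
      simp [Algebra.algebraMap_eq_smul_one]
    have h1 := congrArg (fun B => B (coord (modeEmbed T e.φ) n z)) hinv
    simp only [mul_apply_eq_comp] at h1
    refine h1.symm.trans ?_
    change modeResolvent _ _ _ _ _ ((algebraMap ℝ _ l - e.block T n) _) = _
    rw [hker, map_zero, map_zero]
  · rintro (rfl | ⟨m, hm⟩)
    · intro h0
      refine not_finiteDimensional_eigenspace_one hμ hT hG ?_
      rw [Module.End.eigenspace, h0]
      infer_instance
    · obtain ⟨h, h0, hh⟩ := (isModePair_time hT (hμ m)).exists_eigenvector hT (hμ m) hm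
      refine Module.End.hasEigenvalue_of_hasEigenvector (x := modeEmbed T e.φ m h)
        ⟨Module.End.mem_eigenspace_iff.2 ?_, fun h1 => h0 ?_⟩
      · change G _ = _
        rw [hG.apply_V (isHilbertSum_modeEmbed e.φ), ← map_smul]
        exact congrArg _ hh
      · rw [← map_zero (modeEmbed T e.φ m)] at h1
        exact (modeEmbed T e.φ m).injective h1

omit hμ hT hG in
lemma mem_spectrum_of_hasEigenvalue {X : Type*} [NormedAddCommGroup X] [NormedSpace ℝ X]
    {G : X →L[ℝ] X} {l : ℝ} (hl : Module.End.HasEigenvalue (G : X →ₗ[ℝ] X) l) :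
    l ∈ spectrum ℝ G := by
  obtain ⟨z, hz, hz0⟩ := hl.exists_hasEigenvector
  have hGz : G z = l • z := Module.End.mem_eigenspace_iff.1 hz
  rintro ⟨u, hu⟩
  refine hz0 ?_
  have h1 : (↑u⁻¹ * (algebraMap ℝ (X →L[ℝ] X) l - G)) z = z := by
    rw [← hu, Units.inv_mul]; rfl
  rw [← h1, mul_apply_eq_comp, sub_apply, hGz]
  simp [Algebra.algebraMap_eq_smul_one]

/-- The spectrum contains the limits `0`, `3/2`, `T + 1` of the roots of the cubics. Away from
these, from `1` and from the roots, the resolvents of the blocks are uniformly bounded. -/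
lemma spectrum_eq (hlim : Tendsto e.μ atTop (𝓝 0)) :
    spectrum ℝ G = {0, 1, 3 / 2, T + 1} ∪ {x : ℝ | ∃ m, cubic T (e.μ m) x = 0} := by
  have hlim' : Tendsto e.μ atTop (𝓝[>] 0) :=
    tendsto_nhdsWithin_iff.2 ⟨hlim, Eventually.of_forall hμ⟩
  have hev : ∀ l, (l = 1 ∨ ∃ m, cubic T (e.μ m) l = 0) → l ∈ spectrum ℝ G := fun l hl =>
    mem_spectrum_of_hasEigenvalue ((hasEigenvalue_iff hμ hT hG l).2 hl)
  refine Set.Subset.antisymm (fun l hl => ?_) (Set.union_subset ?_ fun l hl => hev l (Or.inr hl))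
  · by_contra hne
    simp only [Set.mem_union, Set.mem_insert_iff, Set.mem_singleton_iff, Set.mem_ofPred_eq,
      not_or, not_exists] at hne
    obtain ⟨⟨h0, h1, h32, hT1⟩, hroot⟩ := hne
    obtain ⟨K, hK⟩ := exists_norm_block_le hμ hT hlim
    obtain ⟨M, hM⟩ := exists_norm_cubicResolvent_le (A := e.block T) (l := l)
      (isBigO_top.2 ⟨K, fun n => by simpa using hK n⟩)
      (((tendsto_alpha hT).comp hlim').const_add (T + 5 / 2))
      (((tendsto_beta hT).comp hlim').const_add (3 / 2 * (T + 1)))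
      ((tendsto_cubic hT l).comp hlim')
      (mul_ne_zero (mul_ne_zero h0 (sub_ne_zero.2 h32)) (sub_ne_zero.2 hT1))
    refine hG.notMem_spectrum (isHilbertSum_modeEmbed e.φ) hM (fun n => ?_) (fun n => ?_) hl
    · exact ((isModePair_time hT (hμ n)).modeResolvent_mul (hμ n) (hroot n) h1).1
    · exact ((isModePair_time hT (hμ n)).modeResolvent_mul (hμ n) (hroot n) h1).2
  · obtain ⟨l₁, l₂, l₃, hfac, -, t1, t2, t3⟩ := exists_root_functions hT
    have hcl : IsClosed (spectrum ℝ G) := spectrum.isClosed G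
    have hl : ∀ {a : ℝ} {u : ℝ → ℝ}, Tendsto u (𝓝[>] 0) (𝓝 a) →
        (∀ μ, 0 < μ → cubic T μ (u μ) = 0) → a ∈ spectrum ℝ G := fun hu h0 =>
      hcl.mem_of_tendsto (hu.comp hlim')
        (Eventually.of_forall fun m => hev _ (Or.inr ⟨m, h0 _ (hμ m)⟩))
    rintro l (rfl | rfl | rfl | rfl)
    · exact hl t1 fun μ h => by rw [hfac μ h]; ring
    · exact hev _ (Or.inl rfl)
    · exact hl t2 fun μ h => by rw [hfac μ h]; ring
    · exact hl t3 fun μ h => by rw [hfac μ h]; ring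

end Eigensystem

end BackwardHeat

theorem mainTheorem3 (d : ℕ) (hd : 0 < d) (Ω : Set (BackwardHeat.E d)) (hΩo : IsOpen Ω)
    (hΩb : Bornology.IsBounded Ω) (hΩne : Ω.Nonempty) (T : ℝ) (hT : 0 < T) :
    Nonempty (BackwardHeat.Eigensystem Ω) ∧
    ∀ e : BackwardHeat.Eigensystem Ω,
      -- the eigenvalues of the inverse Dirichlet Laplacian
      (∀ m, 0 < e.μ m) ∧ Tendsto e.μ atTop (𝓝 0) ∧
      -- the operator: bounded, self-adjoint, compact perturbation
      (∃ G G₀ : BackwardHeat.Z T Ω →L[ℝ] BackwardHeat.Z T Ω,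
        e.IsTransformedOperator T G ∧ e.IsUnperturbedOperator T G₀ ∧
        IsSelfAdjoint G ∧
        IsCompactOperator (G - G₀) ∧
        -- the eigenvalue `1` and its eigenspace
        Module.End.eigenspace (G : BackwardHeat.Z T Ω →ₗ[ℝ] BackwardHeat.Z T Ω) 1 =
          (Submodule.span ℝ (e.unitEigenvectors T)).topologicalClosure ∧
        ¬ FiniteDimensional ℝ
          (Module.End.eigenspace (G : BackwardHeat.Z T Ω →ₗ[ℝ] BackwardHeat.Z T Ω) 1) ∧
        -- all eigenvalues, and the spectrum
        {x : ℝ | Module.End.HasEigenvalue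
            (G : BackwardHeat.Z T Ω →ₗ[ℝ] BackwardHeat.Z T Ω) x} =
          {1} ∪ {x : ℝ | ∃ m, BackwardHeat.cubic T (e.μ m) x = 0} ∧
        spectrum ℝ G =
          {0, 1, 3 / 2, T + 1} ∪ {x : ℝ | ∃ m, BackwardHeat.cubic T (e.μ m) x = 0}) ∧
      -- the factored form of the cubic
      (∀ᶠ m in atTop, 0 ≤ BackwardHeat.disc T (e.μ m) ∧
        ∀ x : ℝ, BackwardHeat.cubic T (e.μ m) x =
          x * (x - BackwardHeat.lamBar₂ T (e.μ m)) * (x - BackwardHeat.lamBar₃ T (e.μ m))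
            - e.μ m * Real.exp (-(2 * T / e.μ m))) ∧
      Tendsto (fun m => BackwardHeat.lamBar₂ T (e.μ m)) atTop (𝓝 (max (T + 1) (3 / 2))) ∧
      Tendsto (fun m => BackwardHeat.lamBar₃ T (e.μ m)) atTop (𝓝 (min (T + 1) (3 / 2))) ∧
      -- the three sequences of roots
      (∃ l₁ l₂ l₃ : ℕ → ℝ,
        (∀ m, ∀ x : ℝ, BackwardHeat.cubic T (e.μ m) x = (x - l₁ m) * (x - l₂ m) * (x - l₃ m)) ∧
        (∀ m, 0 < l₁ m) ∧
        (l₁ =O[atTop] fun m => e.μ m * Real.exp (-(2 * T / e.μ m))) ∧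
        Tendsto l₁ atTop (𝓝 0) ∧
        Tendsto l₂ atTop (𝓝 (3 / 2)) ∧
        Tendsto l₃ atTop (𝓝 (T + 1))) := by
  refine ⟨BackwardHeat.nonempty_eigensystem hd hΩo hΩb hΩne, fun e => ?_⟩
  have hμ := e.μ_pos hΩo hΩb
  have hlim := e.tendsto_μ hΩo hΩb
  have hlim' : Tendsto e.μ atTop (𝓝[>] 0) :=
    tendsto_nhdsWithin_iff.2 ⟨hlim, Eventually.of_forall hμ⟩
  have hV := BackwardHeat.isHilbertSum_modeEmbed (T := T) e.φ
  obtain ⟨K, hK⟩ := BackwardHeat.Eigensystem.exists_norm_block_le hμ hT hlim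
  have hdiff := BackwardHeat.Eigensystem.tendsto_norm_block_sub hμ hT hlim
  obtain ⟨M, hM⟩ := (Metric.isBounded_range_of_tendsto _ hdiff).exists_norm_le
  obtain ⟨C, hC⟩ := (Metric.isBounded_range_of_tendsto _ hlim).exists_norm_le
  have hK₀ : ∀ n, ‖e.block₀ T n‖ ≤ K + M := fun n => by
    have h1 := hM _ (Set.mem_range_self n)
    rw [norm_norm] at h1
    have h2 := norm_sub_le (e.block T n) (e.block T n - e.block₀ T n)
    rw [sub_sub_cancel] at h2
    exact h2.trans (add_le_add (hK n) h1)
  obtain ⟨G, hG⟩ := BackwardHeat.exists_isBlockDiagonal hV hK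
  obtain ⟨G₀, hG₀⟩ := BackwardHeat.exists_isBlockDiagonal hV hK₀
  obtain ⟨l₁, l₂, l₃, hfac, hpos, t1, t2, t3⟩ := BackwardHeat.exists_root_functions hT
  refine ⟨hμ, hlim, ⟨G, G₀,
    BackwardHeat.Eigensystem.isTransformedOperator_of_isBlockDiagonal hμ
      (fun n => hC _ (Set.mem_range_self n)) hT hG,
    BackwardHeat.Eigensystem.isUnperturbedOperator_of_isBlockDiagonal hμ hT hG₀,
    hG.isSelfAdjoint hV fun n x y => BackwardHeat.modeOp_symmetric _ _ _ _ x y,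
    (hG.sub hG₀).isCompactOperator hV
      (fun n => BackwardHeat.isCompactOperator_modeOp_sub _ _ _ _ _) hdiff,
    BackwardHeat.Eigensystem.eigenspace_one_eq hμ hT hG,
    BackwardHeat.Eigensystem.not_finiteDimensional_eigenspace_one hμ hT hG,
    Set.ext fun x => BackwardHeat.Eigensystem.hasEigenvalue_iff hμ hT hG x,
    BackwardHeat.Eigensystem.spectrum_eq hμ hT hG hlim⟩,
    hlim'.eventually (BackwardHeat.eventually_cubic_eq hT),
    (BackwardHeat.tendsto_lamBar₂ hT).comp hlim', (BackwardHeat.tendsto_lamBar₃ hT).comp hlim',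
    fun m => l₁ (e.μ m), fun m => l₂ (e.μ m), fun m => l₃ (e.μ m),
    fun m => hfac _ (hμ m), fun m => (hpos _ (hμ m)).1, ?_, t1.comp hlim', t2.comp hlim',
    t3.comp hlim'⟩
  refine IsBigO.of_bound 1 (Eventually.of_forall fun m => ?_)
  obtain ⟨h1, h2⟩ := hpos _ (hμ m)
  rw [one_mul, Real.norm_of_nonneg h1.le, Real.norm_of_nonneg (h1.le.trans h2)]
  exact h2
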